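/- In the Collective Graph Exploration problem (CGE) the input is a finite connected simple graph $G$, a vertex $v_{\mathsf{init}}\in V(G)$ and a number $k\ge 1$ of robots. A robot cycle is a closed walk $(v_0=v_{\mathsf{init}},v_1,\dots,v_\ell=v_{\mathsf{init}})$ in $G$ (vertices and edges may repeat, and $\ell=0$ is allowed); its length is $\ell$. A solution is a family of $k$ robot cycles such that every edge of $G$ is traversed by at least one of them; its value is the maximum length of its cycles. Let $\mathrm{OPT}(G,v_{\mathsf{init}},k)$ be the minimum value of a solution, and let $\mathsf{vc}(G)$ be the minimum size of a vertex cover of $G$. **Theorem.** There is an algorithm that, on every input $(G,v_{\mathsf{init}},k)$ as above, runs in time $\mathcal{O}((|V(G)|+|E(G)|)\cdot k)$ and returns a solution of value at most $\mathrm{OPT}(G,v_{\mathsf{init}},k)+8\cdot\mathsf{vc}(G)$. Here the machine model is the unit-cost word RAM with addition and truncated subtraction: there is one fixed program and one constant $C$ such that on every input it halts after at most $C(|V(G)|+|E(G)|)k$ steps, all numbers and addresses handled are at most $C(|V(G)|+|E(G)|)k$, the graph is given as the list of its edges (vertices being $0,\dots,|V(G)|-1$), and the $k$ cycles are written out explicitly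 as vertex sequences. -/

import Mathlib

namespace CGE

/-! ## Collective Graph Exploration -/

section Problem

variable {V : Type*} {G : SimpleGraph V} {v : V} {k : ℕ}

/-- A family of `k` robot cycles (closed walks from `v` to `v`, vertices and edges may repeat) is a
solution if every edge of `G` is traversed by at least one of them. -/
def IsSolution (RC : Fin k → G.Walk v v) : Prop :=
  ∀ e ∈ G.edgeSet, ∃ i, e ∈ (RC i).edges

/-- The value of a family of robot cycles: the maximum number of edges, with repetition, of one of
its cycles. -/
def value (RC : Fin k → G.Walk v v) : ℕ :=
  Finset.univ.sup fun i => (RC i).length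

/-- The minimum value of a solution for `(G, v, k)`. -/
noncomputable def opt (G : SimpleGraph V) (v : V) (k : ℕ) : ℕ :=
  sInf {B | ∃ RC : Fin k → G.Walk v v, IsSolution RC ∧ value RC = B}

end Problem

/-! ## Random access machine

A structured form of the unit-cost word RAM. The memory consists of numbered registers and of
numbered arrays, all holding natural numbers; a program, being a finite text, names only finitely
many of them. The only arithmetic operations are addition and truncated subtraction. Every
operation, memory access, comparison and assignment costs at least one unit of time. A word bound
`W` is imposed on a run: no number that it computes, reads, stores or uses as an address may exceed
`W`, so that a word has `O(log W)` bits. -/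

/-- The contents of the memory. -/
@[ext] structure State where
  /-- the content of each register -/
  reg : ℕ → ℕ
  /-- `arr a i` is the entry of the array with number `a` at address `i` -/
  arr : ℕ → ℕ → ℕ

/-- Expressions: literals, registers, sums, truncated differences, and array entries. -/
inductive Expr where
  | lit (c : ℕ)
  | reg (r : ℕ)
  | add (e f : Expr)
  | sub (e f : Expr)
  | get (a : ℕ) (i : Expr)

/-- The value of an expression. -/
def Expr.eval (s : State) : Expr → ℕ
  | .lit c => c
  | .reg r => s.reg r
  | .add e f => e.eval s + f.eval s
  | .sub e f => e.eval s - f.eval s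
  | .get a i => s.arr a (i.eval s)

/-- The time to evaluate an expression: its number of nodes. -/
def Expr.cost : Expr → ℕ
  | .lit _ => 1
  | .reg _ => 1
  | .add e f => e.cost + f.cost + 1
  | .sub e f => e.cost + f.cost + 1
  | .get _ i => i.cost + 1

/-- All numbers that occur in the evaluation of an expression are at most `W`. -/
def Expr.Fits (W : ℕ) (s : State) : Expr → Prop
  | .lit c => c ≤ W
  | .reg r => s.reg r ≤ W
  | .add e f => e.Fits W s ∧ f.Fits W s ∧ e.eval s + f.eval s ≤ W
  | .sub e f => e.Fits W s ∧ f.Fits W s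
  | .get a i => i.Fits W s ∧ s.arr a (i.eval s) ≤ W

/-- Programs. `assign r e` puts the value of `e` into register `r`; `store a i e` puts the value of
`e` into array `a` at address `i`; `ifLt e f c d` runs `c` if `e < f` and `d` otherwise;
`whileLt e f c` repeats `c` as long as `e < f`. -/
inductive Prog where
  | skip
  | assign (r : ℕ) (e : Expr)
  | store (a : ℕ) (i e : Expr)
  | seq (c d : Prog)
  | ifLt (e f : Expr) (c d : Prog)
  | whileLt (e f : Expr) (c : Prog)

/-- The memory after writing `x` to register `r`. -/
def State.setReg (s : State) (r x : ℕ) : State :=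
  { s with reg := Function.update s.reg r x }

/-- The memory after writing `x` to array `a` at address `i`. -/
def State.setArr (s : State) (a i x : ℕ) : State :=
  { s with arr := Function.update s.arr a (Function.update (s.arr a) i x) }

/-- `Run W c s t s'`: started on memory `s`, the program `c` halts after exactly `t` units of time
with memory `s'`, and no number handled in the course of the computation exceeds `W`. -/
inductive Run (W : ℕ) : Prog → State → ℕ → State → Prop where
  | skip (s : State) : Run W .skip s 1 s
  | assign (s : State) (r : ℕ) (e : Expr) (he : e.Fits W s) :
      Run W (.assign r e) s (e.cost + 1) (s.setReg r (e.eval s))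
  | store (s : State) (a : ℕ) (i e : Expr) (hi : i.Fits W s) (he : e.Fits W s) :
      Run W (.store a i e) s (i.cost + e.cost + 1) (s.setArr a (i.eval s) (e.eval s))
  | seq {c d : Prog} {s₁ s₂ s₃ : State} {t u : ℕ} (hc : Run W c s₁ t s₂) (hd : Run W d s₂ u s₃) :
      Run W (.seq c d) s₁ (t + u) s₃
  | ifTrue {e f : Expr} {c : Prog} (d : Prog) {s s' : State} {t : ℕ}
      (he : e.Fits W s) (hf : f.Fits W s) (h : e.eval s < f.eval s) (hc : Run W c s t s') :
      Run W (.ifLt e f c d) s (e.cost + f.cost + 1 + t) s'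
  | ifFalse {e f : Expr} (c : Prog) {d : Prog} {s s' : State} {t : ℕ}
      (he : e.Fits W s) (hf : f.Fits W s) (h : ¬ e.eval s < f.eval s) (hd : Run W d s t s') :
      Run W (.ifLt e f c d) s (e.cost + f.cost + 1 + t) s'
  | whileTrue {e f : Expr} {c : Prog} {s₁ s₂ s₃ : State} {t u : ℕ}
      (he : e.Fits W s₁) (hf : f.Fits W s₁) (h : e.eval s₁ < f.eval s₁)
      (hc : Run W c s₁ t s₂) (hw : Run W (.whileLt e f c) s₂ u s₃) :
      Run W (.whileLt e f c) s₁ (e.cost + f.cost + 1 + t + u) s₃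
  | whileFalse {e f : Expr} (c : Prog) {s : State}
      (he : e.Fits W s) (hf : f.Fits W s) (h : ¬ e.eval s < f.eval s) :
      Run W (.whileLt e f c) s (e.cost + f.cost + 1) s

/-! ## Input and output -/

/-- `L` lists the edges of `G`, each of them exactly once, in any order and each with its endpoints
in any order. -/
def ListsEdges {n : ℕ} (G : SimpleGraph (Fin n)) (L : List (Fin n × Fin n)) : Prop :=
  (L.map fun p => s(p.1, p.2)).Nodup ∧ ∀ e, e ∈ L.map (fun p => s(p.1, p.2)) ↔ e ∈ G.edgeSet

/-- The initial memory. Registers `0, 1, 2, 3` hold the number of vertices, the number of edges,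
the initial vertex and the number of robots; arrays `0` and `1` hold, at address `j`, the first and
the second endpoint of the `j`-th edge of the list. All the rest is zero. -/
def input {n : ℕ} (L : List (Fin n × Fin n)) (v : Fin n) (k : ℕ) : State where
  reg r := match r with
    | 0 => n
    | 1 => L.length
    | 2 => v
    | 3 => k
    | _ => 0
  arr a j := match a, L[j]? with
    | 0, some p => p.1
    | 1, some p => p.2
    | _, _ => 0

/-- The memory `s` contains the family `RC` of robot cycles as output: array `2` holds the length
of the `i`-th cycle at address `i`, and array `3` holds the vertex sequences
`v₀, v₁, …, v_ℓ` of the cycles written explicitly one after another. -/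
def Outputs {n : ℕ} {G : SimpleGraph (Fin n)} {v : Fin n} {k : ℕ} (s : State)
    (RC : Fin k → G.Walk v v) : Prop :=
  ∀ i : Fin k, s.arr 2 i = (RC i).length ∧
    ∀ j ≤ (RC i).length,
      s.arr 3 ((∑ i' ∈ Finset.univ.filter (· < i), ((RC i').length + 1)) + j) =
        ((RC i).getVert j : ℕ)

end CGE

/-! The algorithm doubles some edges of `G` until all degrees are even, takes an Euler tour, cuts it
into `k` blocks of nearly equal length, and lets each robot go along a tree path to the start of its
block, traverse the block, and return along a tree path. Let `m` be the number of edges of `G`, `S`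
a vertex cover, and `o` the number of vertices outside `S` that have odd degree.

Lower bound (`card_edgeFinset_add_le`). In a solution each vertex is met an even number of times by
edge ends, counted with multiplicity. So a vertex of odd degree has an incident edge that is
traversed at least twice. Vertices outside `S` are pairwise nonadjacent, so these edges are distinct
for distinct such vertices, and `m + o ≤ k * opt`.

Augmentation (`runs_fixParities`, `Augments.le_add`). In a spanning tree, processed from the leaves
towards the root, the edge to the parent is doubled at each vertex whose current parity is odd. A
vertex without children still has its original parity then; a vertex outside `S` with a child is the
parent of a member of `S`. Hence at most `o + 2 * S.card` edges are added. The root becomes even by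
the handshake lemma.

Value (`IsResult.exists_solution`). With `M ≤ m + o + 2 * S.card` edges after doubling, the block
length `B = ⌈M / k⌉` is at most `opt + 2 * S.card`. Of two consecutive vertices on a path one lies
in `S`, so tree paths from the root have length at most `2 * S.card` (`IsRooted.dep_le`). Each cycle
therefore has length at most `B + 4 * S.card`, which is within the claimed bound.

Time. One trail search in the style of Hierholzer yields both a spanning tree and, when all degrees
are even, an Euler tour (`Search.Euler.push`, `Search.Euler.pop`). It runs once on `G` for the tree
and once on the augmented graph for the tour, in linear time. Writing the cycles costs `O(n + B)`
per robot, and `k * (n + B)` is `O((n + m) * k)`. The programs are verified with weakest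
preconditions for loop-free code and a loop rule with an iteration bound (`Runs.of_wp`,
`Runs.while`). -/

namespace CGE

/-! ## Program logic -/

/-- The program `c`, started on `s`, halts within time `T` in a memory satisfying `Q`, and all
numbers handled are at most `W`. -/
def Runs (W : ℕ) (c : Prog) (s : State) (T : ℕ) (Q : State → Prop) : Prop :=
  ∃ t s', Run W c s t s' ∧ t ≤ T ∧ Q s'

/-- Weakest preconditions of loop-free programs. -/
def Prog.wp (W : ℕ) : Prog → (State → Prop) → State → Prop
  | .skip, Q, s => Q s
  | .assign r e, Q, s => e.Fits W s ∧ Q (s.setReg r (e.eval s))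
  | .store a i e, Q, s => i.Fits W s ∧ e.Fits W s ∧ Q (s.setArr a (i.eval s) (e.eval s))
  | .seq c d, Q, s => c.wp W (d.wp W Q) s
  | .ifLt e f c d, Q, s => e.Fits W s ∧ f.Fits W s ∧
      (e.eval s < f.eval s → c.wp W Q s) ∧ (¬ e.eval s < f.eval s → d.wp W Q s)
  -- Loops are excluded here and treated by `Runs.while`; the value that `Prog.time` gives to a loop
  -- is therefore never used.
  | .whileLt _ _ _, _, _ => False

/-- An upper bound for the time taken by a loop-free program. -/
def Prog.time : Prog → ℕ
  | .skip => 1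
  | .assign _ e => e.cost + 1
  | .store _ i e => i.cost + e.cost + 1
  | .seq c d => c.time + d.time
  | .ifLt e f c d => e.cost + f.cost + 1 + (c.time + d.time)
  | .whileLt _ _ _ => 0

/-- `c.writesReg r` tells whether the program `c` mentions an assignment to register `r`. -/
def Prog.writesReg : Prog → ℕ → Bool
  | .skip, _ => false
  | .assign r _, q => q == r
  | .store _ _ _, _ => false
  | .seq c d, q => c.writesReg q || d.writesReg q
  | .ifLt _ _ c d, q => c.writesReg q || d.writesReg q
  | .whileLt _ _ c, q => c.writesReg q

/-- `c.writesArr a` tells whether the program `c` mentions a store to array `a`. -/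
def Prog.writesArr : Prog → ℕ → Bool
  | .skip, _ => false
  | .assign _ _, _ => false
  | .store a _ _, q => q == a
  | .seq c d, q => c.writesArr q || d.writesArr q
  | .ifLt _ _ c d, q => c.writesArr q || d.writesArr q
  | .whileLt _ _ c, q => c.writesArr q

/-- The registers and arrays not written by `c` agree in `s` and `s'`. -/
def Frame (c : Prog) (s s' : State) : Prop :=
  (∀ r, c.writesReg r = false → s'.reg r = s.reg r) ∧
    ∀ a, c.writesArr a = false → s'.arr a = s.arr a

theorem Frame.refl (c : Prog) (s : State) : Frame c s s := ⟨fun _ _ => rfl, fun _ _ => rfl⟩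

theorem Frame.trans {c : Prog} {s s' s'' : State} (h : Frame c s s') (h' : Frame c s' s'') :
    Frame c s s'' :=
  ⟨fun r hr => (h'.1 r hr).trans (h.1 r hr), fun a ha => (h'.2 a ha).trans (h.2 a ha)⟩

/-- Since `writesReg` and `writesArr` are computed from the program text, that a memory cell is
unchanged across any piece of code, loops included, can be proved by `rfl` from the resulting frame.
-/
theorem Run.frame {W t : ℕ} {c : Prog} {s s' : State} (h : Run W c s t s') : Frame c s s' := by
  induction h with
  | skip => exact .refl _ _
  | assign s r e =>
    refine ⟨fun q hq => ?_, fun _ _ => rfl⟩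
    have : q ≠ r := by simpa [Prog.writesReg] using hq
    simp [State.setReg, this]
  | store s a i e =>
    refine ⟨fun _ _ => rfl, fun q hq => ?_⟩
    have : q ≠ a := by simpa [Prog.writesArr] using hq
    simp [State.setArr, this]
  | seq _ _ ih ih' =>
    refine ⟨fun q hq => ?_, fun q hq => ?_⟩
    · simp only [Prog.writesReg, Bool.or_eq_false_iff] at hq
      rw [ih'.1 q hq.2, ih.1 q hq.1]
    · simp only [Prog.writesArr, Bool.or_eq_false_iff] at hq
      rw [ih'.2 q hq.2, ih.2 q hq.1]
  | ifTrue _ _ _ _ _ ih =>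
    refine ⟨fun q hq => ih.1 q ?_, fun q hq => ih.2 q ?_⟩
    · simp only [Prog.writesReg, Bool.or_eq_false_iff] at hq; exact hq.1
    · simp only [Prog.writesArr, Bool.or_eq_false_iff] at hq; exact hq.1
  | ifFalse _ _ _ _ _ ih =>
    refine ⟨fun q hq => ih.1 q ?_, fun q hq => ih.2 q ?_⟩
    · simp only [Prog.writesReg, Bool.or_eq_false_iff] at hq; exact hq.2
    · simp only [Prog.writesArr, Bool.or_eq_false_iff] at hq; exact hq.2
  | whileTrue _ _ _ _ _ ih ih' =>
    exact ⟨fun q hq => (ih'.1 q hq).trans (ih.1 q hq), fun q hq => (ih'.2 q hq).trans (ih.2 q hq)⟩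
  | whileFalse => exact .refl _ _

/-! ### Rules for composition, straight-line code and loops -/

section Rules

variable {W T T' : ℕ} {c d : Prog} {e f : Expr} {s : State} {Q R : State → Prop}

theorem Runs.mono (h : Runs W c s T Q) (hT : T ≤ T') (hQ : ∀ s', Frame c s s' → Q s' → R s') :
    Runs W c s T' R := by
  obtain ⟨t, s', hr, ht, hq⟩ := h
  exact ⟨t, s', hr, ht.trans hT, hQ s' hr.frame hq⟩

theorem Runs.seq (h : Runs W c s T Q) (h' : ∀ s', Frame c s s' → Q s' → Runs W d s' T' R) :
    Runs W (.seq c d) s (T + T') R := by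
  obtain ⟨t, s', hr, ht, hq⟩ := h
  obtain ⟨t', s'', hr', ht', hq'⟩ := h' s' hr.frame hq
  exact ⟨_, s'', .seq hr hr', by omega, hq'⟩

/-- This turns straight-line code into a conjunction of arithmetic side conditions and one statement
about an explicit final memory. -/
theorem Runs.of_wp (h : c.wp W Q s) : Runs W c s c.time Q := by
  induction c generalizing s Q with
  | skip => exact ⟨_, _, .skip s, le_rfl, h⟩
  | assign r e => exact ⟨_, _, .assign s r e h.1, le_rfl, h.2⟩
  | store a i e => exact ⟨_, _, .store s a i e h.1 h.2.1, le_rfl, h.2.2⟩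
  | seq c d ihc ihd => exact (ihc h).seq fun s' _ hs' => ihd hs'
  | ifLt e f c d ihc ihd =>
    by_cases hlt : e.eval s < f.eval s
    · obtain ⟨t, s', hr, ht, hq⟩ := ihc (h.2.2.1 hlt)
      exact ⟨_, s', .ifTrue d h.1 h.2.1 hlt hr, by simp only [Prog.time]; omega, hq⟩
    · obtain ⟨t, s', hr, ht, hq⟩ := ihd (h.2.2.2 hlt)
      exact ⟨_, s', .ifFalse c h.1 h.2.1 hlt hr, by simp only [Prog.time]; omega, hq⟩
  | whileLt e f c ih => exact h.elim

theorem Runs.of_wp_le (hT : c.time ≤ T) (h : c.wp W Q s) : Runs W c s T Q :=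
  (Runs.of_wp h).mono hT fun _ _ h => h

/-- The rule for loops: `I m` is the invariant, where `m` bounds the number of iterations left. -/
theorem Runs.while (I : ℕ → State → Prop) {m : ℕ} (h0 : I m s)
    (hstep : ∀ m s', Frame c s s' → I m s' → e.Fits W s' ∧ f.Fits W s' ∧
      (e.eval s' < f.eval s' → Runs W c s' T fun s'' => ∃ m' < m, I m' s'')) :
    Runs W (.whileLt e f c) s ((m + 1) * (T + e.cost + f.cost + 1))
      fun s' => (∃ m', I m' s') ∧ ¬ e.eval s' < f.eval s' := by
  suffices H : ∀ m s', Frame c s s' → I m s' →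
      Runs W (.whileLt e f c) s' ((m + 1) * (T + e.cost + f.cost + 1))
        fun s' => (∃ m', I m' s') ∧ ¬ e.eval s' < f.eval s' from H _ s (.refl _ _) h0
  intro m
  induction m using Nat.strong_induction_on with
  | _ m ih =>
    intro s' hF hI
    obtain ⟨he, hf, hb⟩ := hstep m s' hF hI
    by_cases hlt : e.eval s' < f.eval s'
    · obtain ⟨t, s'', hr, ht, m', hm, hI'⟩ := hb hlt
      obtain ⟨t', s₃, hr', ht', hq⟩ := ih m' hm s'' (hF.trans hr.frame) hI'
      refine ⟨_, s₃, .whileTrue he hf hlt hr hr', ?_, hq⟩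
      have := Nat.mul_le_mul_right (T + e.cost + f.cost + 1) (Nat.succ_le_of_lt hm)
      rw [Nat.succ_mul m]
      simp only [Nat.succ_eq_add_one] at this
      omega
    · refine ⟨_, s', .whileFalse c he hf hlt, ?_, ⟨m, hI⟩, hlt⟩
      rw [Nat.succ_mul m]
      omega

end Rules

section Eval

variable (s : State) (r q x a b i : ℕ)

theorem State.setReg_reg : (s.setReg r x).reg q = if q = r then x else s.reg q := by
  simp [State.setReg, Function.update_apply]

theorem State.setReg_arr : (s.setReg r x).arr = s.arr := rfl

theorem State.setArr_reg : (s.setArr a i x).reg = s.reg := rfl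

theorem State.setArr_arr :
    (s.setArr a i x).arr b = if b = a then Function.update (s.arr a) i x else s.arr b := by
  by_cases h : b = a
  · subst h; simp [State.setArr]
  · simp [State.setArr, h]

end Eval

/-! ## Trail search: the abstract algorithm

A multigraph on `{0, …, n - 1}` with edges `0, …, M - 1` is given by the endpoints `a e` and `b e` of
each edge `e`. -/

/-- The edge `e` joins `x` and `y`. -/
def Joins (a b : ℕ → ℕ) (e x y : ℕ) : Prop := (a e = x ∧ b e = y) ∨ (a e = y ∧ b e = x)

theorem Joins.symm {a b : ℕ → ℕ} {e x y : ℕ} (h : Joins a b e x y) : Joins a b e y x := Or.symm h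

/-- `par`, `dep` and `ord` describe a tree with root `v`: `ord` lists its `cnt` vertices, `par x - 1`
is the parent of `x`, and `dep x` the depth. -/
structure IsTree (a b : ℕ → ℕ) (n M v : ℕ) (par dep ord : ℕ → ℕ) (cnt : ℕ) : Prop where
  cnt_pos : 0 < cnt
  ord_zero : ord 0 = v
  -- The value `0` of `par` marks vertices not yet reached, so the root is given itself as parent.
  par_root : par v = v + 1
  dep_root : dep v = 0
  ord_lt : ∀ i < cnt, ord i < n ∧ par (ord i) ≠ 0
  ord_surj : ∀ x < n, par x ≠ 0 → ∃ i < cnt, ord i = x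
  ord_inj : ∀ i < cnt, ∀ j < cnt, ord i = ord j → i = j
  parent : ∀ i < cnt, 0 < i → ∃ j < i, par (ord i) = ord j + 1 ∧ dep (ord i) = dep (ord j) + 1 ∧
    ∃ e < M, Joins a b e (ord i) (ord j)

/-- The state of the search: `st` and `out` are the stack and the output, with `sp` and `op` entries,
`used` marks the edges traversed, `adj` holds the edges still to be examined at each vertex. -/
structure Search where
  adj : ℕ → List ℕ
  used : ℕ → ℕ
  st : ℕ → ℕ
  sp : ℕ
  out : ℕ → ℕ
  op : ℕ
  par : ℕ → ℕ
  dep : ℕ → ℕ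
  ord : ℕ → ℕ
  cnt : ℕ

open Function in
/-- Drop the first edge from the list of `u`. -/
def Search.drop (σ : Search) (u : ℕ) : Search :=
  { σ with adj := update σ.adj u (σ.adj u).tail }

open Function in
/-- Traverse the edge `e` from `u` to `w`. -/
def Search.push (σ : Search) (u e w : ℕ) : Search :=
  { σ with
    adj := update σ.adj u (σ.adj u).tail
    used := update σ.used e 1
    st := update σ.st σ.sp w
    sp := σ.sp + 1
    par := if σ.par w = 0 then update σ.par w (u + 1) else σ.par
    dep := if σ.par w = 0 then update σ.dep w (σ.dep u + 1) else σ.dep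
    ord := if σ.par w = 0 then update σ.ord σ.cnt w else σ.ord
    cnt := if σ.par w = 0 then σ.cnt + 1 else σ.cnt }

open Function in
/-- Move the top `u` of the stack to the output. -/
def Search.pop (σ : Search) (u : ℕ) : Search :=
  { σ with
    out := update σ.out σ.op u
    op := σ.op + 1
    sp := σ.sp - 1 }

/-- The invariants of the search that do not depend on degrees. -/
structure Search.Inv (a b : ℕ → ℕ) (n M v : ℕ) (σ : Search) : Prop where
  tree : IsTree a b n M v σ.par σ.dep σ.ord σ.cnt
  adj_inc : ∀ u < n, ∀ e ∈ σ.adj u, e < M ∧ (a e = u ∨ b e = u)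
  -- Lists are pruned lazily: a used edge may remain in the list of its other endpoint, but no
  -- unused edge is ever lost.
  mem_adj : ∀ e < M, σ.used e = 0 → e ∈ σ.adj (a e) ∧ e ∈ σ.adj (b e)
  used_le : ∀ e < M, σ.used e ≤ 1
  par_of_used : ∀ e < M, σ.used e ≠ 0 → σ.par (a e) ≠ 0 ∧ σ.par (b e) ≠ 0
  st_lt : ∀ i < σ.sp, σ.st i < n ∧ σ.par (σ.st i) ≠ 0
  out_lt : ∀ i < σ.op, σ.out i < n ∧ σ.adj (σ.out i) = []
  visited : ∀ x < n, σ.par x ≠ 0 → (∃ i < σ.sp, σ.st i = x) ∨ ∃ i < σ.op, σ.out i = x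
  -- A traversal adds one stack entry, a pop moves one entry to the output. This bounds all stack
  -- and output addresses and fixes the length of the final output.
  count : σ.sp + σ.op = 1 + ∑ e ∈ Finset.range M, σ.used e

/-- The degree of `x` in the graph formed by the unused edges. -/
def unusedDegree (a b : ℕ → ℕ) (M : ℕ) (used : ℕ → ℕ) (x : ℕ) : ℕ :=
  ∑ e ∈ Finset.range M,
    if used e = 0 then (if a e = x then 1 else 0) + (if b e = x then 1 else 0) else 0

/-- The invariants of the search in a graph with even degrees: the remaining graph has even
degrees, except possibly at the top of the stack and at `c`, where `c` is adjacent to the last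
vertex of the output. -/
structure Search.Euler (a b : ℕ → ℕ) (M v : ℕ) (σ : Search) (c : ℕ) : Prop where
  st_zero : 0 < σ.sp → σ.st 0 = v
  st_adj : ∀ i, i + 1 < σ.sp → ∃ e < M, Joins a b e (σ.st i) (σ.st (i + 1))
  out_zero : 0 < σ.op → σ.out 0 = v
  out_adj : ∀ i, i + 1 < σ.op → ∃ e < M, Joins a b e (σ.out i) (σ.out (i + 1))
  final : σ.sp = 0 → 0 < σ.op ∧ σ.out (σ.op - 1) = v
  parity : 0 < σ.sp → ∀ x, (unusedDegree a b M σ.used x +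
    (if x = σ.st (σ.sp - 1) then 1 else 0) + (if x = c then 1 else 0)) % 2 = 0
  link : 0 < σ.sp → (σ.op = 0 ∧ c = v) ∨ (0 < σ.op ∧ ∃ e < M, Joins a b e c (σ.out (σ.op - 1)))
  cover : ∀ e < M, σ.used e ≠ 0 →
    (∃ i, i + 1 < σ.sp ∧ Joins a b e (σ.st i) (σ.st (i + 1))) ∨
    (∃ i, i + 1 < σ.op ∧ Joins a b e (σ.out i) (σ.out (i + 1))) ∨
    -- The edge that links stack and output: one end is already in the output, and the other end `c`
    -- is still on the stack.
    (0 < σ.sp ∧ 0 < σ.op ∧ Joins a b e c (σ.out (σ.op - 1)))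

section IsTree

variable {a b : ℕ → ℕ} {n M v : ℕ} {par dep ord : ℕ → ℕ} {cnt : ℕ}

theorem IsTree.cnt_le (h : IsTree a b n M v par dep ord cnt) : cnt ≤ n := by
  have := Finset.card_le_card_of_injOn (s := Finset.range cnt) (t := Finset.range n) ord
    (fun i hi => by simpa using (h.ord_lt i (by simpa using hi)).1)
    (fun i hi j hj hij => h.ord_inj i (by simpa using hi) j (by simpa using hj) hij)
  simpa using this

theorem IsTree.dep_lt (h : IsTree a b n M v par dep ord cnt) {x : ℕ} (hx : x < n)
    (hp : par x ≠ 0) : dep x < n := by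
  obtain ⟨i, hi, rfl⟩ := h.ord_surj x hx hp
  have key : ∀ i, i < cnt → dep (ord i) ≤ i := by
    intro i
    induction i using Nat.strong_induction_on with
    | _ i ih =>
      intro hi
      rcases Nat.eq_zero_or_pos i with rfl | hpos
      · simp [h.ord_zero, h.dep_root]
      · obtain ⟨j, hj, -, hd, -⟩ := h.parent i hi hpos
        have := ih j hj (by omega)
        omega
  have := key i hi
  have := h.cnt_le
  omega

theorem IsTree.par_le (h : IsTree a b n M v par dep ord cnt) {x : ℕ} (hx : x < n) :
    par x ≤ n := by
  by_cases hp : par x = 0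
  · omega
  obtain ⟨i, hi, rfl⟩ := h.ord_surj x hx hp
  rcases Nat.eq_zero_or_pos i with rfl | hpos
  · have := (h.ord_lt 0 hi).1
    rw [h.ord_zero] at this ⊢
    rw [h.par_root]; omega
  · obtain ⟨j, hj, he, -⟩ := h.parent i hi hpos
    have := (h.ord_lt j (by omega)).1
    omega

-- The new vertex gets the index `cnt`, so its parent has a smaller index and the old entries are
-- untouched.
open Function in
theorem IsTree.insert (h : IsTree a b n M v par dep ord cnt) {u w e : ℕ} (hu : u < n) (hw : w < n)
    (hpu : par u ≠ 0) (hpw : par w = 0) (he : e < M) (hjoin : Joins a b e w u) :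
    IsTree a b n M v (update par w (u + 1)) (update dep w (dep u + 1)) (update ord cnt w)
      (cnt + 1) := by
  obtain ⟨i, hi, rfl⟩ := h.ord_surj u hu hpu
  have hne : ∀ j < cnt, ord j ≠ w := fun j hj e => (h.ord_lt j hj).2 (e ▸ hpw)
  have hold : ∀ j < cnt, update ord cnt w j = ord j := fun j hj => by
    rw [update_apply, if_neg (by omega)]
  have hv : v ≠ w := h.ord_zero ▸ hne 0 h.cnt_pos
  have hparo : ∀ j < cnt, update par w (ord i + 1) (ord j) = par (ord j) := fun j hj => by
    rw [update_apply, if_neg (hne j hj)]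
  have hdepo : ∀ j < cnt, update dep w (dep (ord i) + 1) (ord j) = dep (ord j) := fun j hj => by
    rw [update_apply, if_neg (hne j hj)]
  refine ⟨by omega, by rw [hold 0 h.cnt_pos, h.ord_zero], by rw [update_apply, if_neg hv, h.par_root],
    by rw [update_apply, if_neg hv, h.dep_root], fun j hj' => ?_, fun x hx hp => ?_,
    fun j hj k hk => ?_, fun j hj hpos => ?_⟩
  · rcases Nat.lt_succ_iff_lt_or_eq.1 hj' with hlt | rfl
    · rw [hold j hlt, hparo j hlt]; exact h.ord_lt j hlt
    · simpa using hw
  · by_cases hxw : x = w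
    · exact ⟨cnt, by omega, by simp [hxw]⟩
    · rw [update_apply, if_neg hxw] at hp
      obtain ⟨j, hj, rfl⟩ := h.ord_surj x hx hp
      exact ⟨j, by omega, hold j hj⟩
  · have := h.ord_inj j
    grind
  · rcases Nat.lt_succ_iff_lt_or_eq.1 hj with hlt | rfl
    · obtain ⟨k, hk, h1, h2, h3⟩ := h.parent j hlt hpos
      refine ⟨k, hk, ?_⟩
      rw [hold j hlt, hold k (by omega), hparo j hlt, hdepo j hlt, hdepo k (by omega)]
      exact ⟨h1, h2, h3⟩
    · refine ⟨i, hi, ?_⟩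
      rw [hold i hi, hdepo i hi]
      simpa using ⟨e, he, hjoin⟩

end IsTree

/-! ### Preservation of the search invariants -/

section Search

variable {a b : ℕ → ℕ} {n M v : ℕ} {σ : Search} {u e : ℕ} {l : List ℕ}

/-- A used edge may be dropped because `mem_adj` speaks of unused edges only. -/
theorem Search.Inv.drop (h : σ.Inv a b n M v) (hl : σ.adj u = e :: l)
    (hused : σ.used e ≠ 0) : (σ.drop u).Inv a b n M v := by
  refine ⟨h.tree, ?_, ?_, h.used_le, h.par_of_used, h.st_lt, ?_, h.visited, h.count⟩
  · intro x hx f hf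
    have := h.adj_inc x hx f
    simp only [Search.drop, Function.update_apply] at hf
    grind
  · intro f hf hf0
    have := h.mem_adj f hf hf0
    simp only [Search.drop, Function.update_apply] at hf0 ⊢
    grind
  · intro i hi
    have := h.out_lt i hi
    simp only [Search.drop, Function.update_apply]
    grind

/-- Since `u` is one endpoint of `e`, the other one is `a e + b e - u`, which the machine can
compute without a case distinction. -/
theorem Search.Inv.push (h : σ.Inv a b n M v) (hab : ∀ e < M, a e < n ∧ b e < n)
    (hsp : 0 < σ.sp) (hu : σ.st (σ.sp - 1) = u)
    (hl : σ.adj u = e :: l) (hused : σ.used e = 0) :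
    (σ.push u e (a e + b e - u)).Inv a b n M v := by
  obtain ⟨hun, hup⟩ := h.st_lt (σ.sp - 1) (by omega)
  rw [hu] at hun hup
  obtain ⟨heM, hinc⟩ := h.adj_inc u hun e (by simp [hl])
  obtain ⟨hae, hbe⟩ := hab e heM
  set w := a e + b e - u with hw
  have hwn : w < n := by grind
  have hjo : Joins a b e w u := by unfold Joins; grind
  have hpar : ∀ x, σ.par x ≠ 0 → (σ.push u e w).par x ≠ 0 := by
    intro x hx
    simp only [Search.push]
    split_ifs with h0
    · simp only [Function.update_apply]; grind
    · exact hx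
  have hparw : (σ.push u e w).par w ≠ 0 := by
    simp only [Search.push]
    split_ifs with h0
    · simp
    · exact h0
  refine ⟨?_, ?_, ?_, ?_, ?_, ?_, ?_, ?_, ?_⟩
  · by_cases h0 : σ.par w = 0
    · simpa [Search.push, h0] using h.tree.insert hun hwn hup h0 heM hjo
    · simpa [Search.push, h0] using h.tree
  · intro x hx f hf
    have := h.adj_inc x hx f
    simp only [Search.push, Function.update_apply] at hf
    grind
  · intro f hf hf0
    have := h.mem_adj f hf
    simp only [Search.push, Function.update_apply] at hf0 ⊢
    grind
  · intro f hf
    have := h.used_le f hf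
    simp only [Search.push, Function.update_apply]
    grind
  · intro f hf hf0
    by_cases hfe : f = e
    · subst hfe
      have := hpar u hup
      unfold Joins at hjo
      grind
    · have := h.par_of_used f hf (by simpa [Search.push, Function.update_apply, hfe] using hf0)
      exact ⟨hpar _ this.1, hpar _ this.2⟩
  · intro i hi
    by_cases his : i = σ.sp
    · have : (σ.push u e w).st i = w := by simp [Search.push, his]
      rw [this]; exact ⟨hwn, hparw⟩
    · have h1 : (σ.push u e w).st i = σ.st i := by simp [Search.push, his]
      have h2 := h.st_lt i (by simp only [Search.push] at hi; omega)
      rw [h1]; exact ⟨h2.1, hpar _ h2.2⟩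
  · intro i hi
    have := h.out_lt i hi
    simp only [Search.push, Function.update_apply]
    grind
  · intro x hx hp
    by_cases hxw : x = w
    · exact .inl ⟨σ.sp, by simp [Search.push], by simp [Search.push, hxw]⟩
    · have hp' : σ.par x ≠ 0 := by
        simp only [Search.push] at hp
        split_ifs at hp
        · simpa [Function.update_apply, hxw] using hp
        · exact hp
      rcases h.visited x hx hp' with ⟨i, hi, hix⟩ | ⟨i, hi, hix⟩
      · refine .inl ⟨i, by simp only [Search.push]; omega, ?_⟩
        simp only [Search.push, Function.update_apply]
        rw [if_neg (by omega), hix]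
      · exact .inr ⟨i, hi, hix⟩
  · have h1 : ∑ f ∈ Finset.range M, (σ.push u e w).used f
        = 1 + ∑ f ∈ Finset.range M, σ.used f := by
      simp only [Search.push]
      rw [Finset.sum_update_of_mem (Finset.mem_range.2 heM),
        ← Finset.add_sum_erase _ σ.used (Finset.mem_range.2 heM), hused, zero_add,
        Finset.sdiff_singleton_eq_erase]
    have := h.count
    rw [h1]
    simp only [Search.push]
    omega

theorem Search.Inv.pop (h : σ.Inv a b n M v) (hsp : 0 < σ.sp) (hu : σ.st (σ.sp - 1) = u)
    (hl : σ.adj u = []) : (σ.pop u).Inv a b n M v := by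
  refine ⟨h.tree, h.adj_inc, h.mem_adj, h.used_le, h.par_of_used, ?_, ?_, ?_, ?_⟩
  · intro i hi
    exact h.st_lt i (by simp only [Search.pop] at hi; omega)
  · intro i hi
    have := h.out_lt i
    have := h.st_lt (σ.sp - 1) (by omega)
    simp only [Search.pop, Function.update_apply] at hi ⊢
    grind
  · intro x hx hp
    simp only [Search.pop]
    rcases h.visited x hx hp with ⟨i, hi, hix⟩ | ⟨i, hi, hix⟩
    · by_cases hii : i = σ.sp - 1
      · exact .inr ⟨σ.op, by omega, by subst hii; simp [← hix, hu]⟩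
      · exact .inl ⟨i, by omega, hix⟩
    · exact .inr ⟨i, by omega, by rw [Function.update_apply, if_neg (by omega), hix]⟩
  · have := h.count
    simp only [Search.pop]
    omega

variable {c : ℕ}

theorem unusedDegree_update {used : ℕ → ℕ} (he : e < M) (hused : used e = 0) (x : ℕ) :
    unusedDegree a b M used x = unusedDegree a b M (Function.update used e 1) x +
      (if a e = x then 1 else 0) + (if b e = x then 1 else 0) := by
  unfold unusedDegree
  rw [← Finset.add_sum_erase _ _ (Finset.mem_range.2 he),
    ← Finset.add_sum_erase (Finset.range M) _ (Finset.mem_range.2 he)]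
  rw [if_pos hused, Function.update_self, if_neg one_ne_zero]
  have : ∀ f ∈ (Finset.range M).erase e,
      (if used f = 0 then (if a f = x then 1 else 0) + (if b f = x then 1 else 0) else 0)
      = (if Function.update used e 1 f = 0 then
        (if a f = x then 1 else 0) + (if b f = x then 1 else 0) else 0) := by
    intro f hf
    rw [Function.update_of_ne (Finset.ne_of_mem_erase hf)]
  rw [Finset.sum_congr rfl this]
  omega

/-- Using `e` changes the parity of the unused degree at `u` and at `w`; this is balanced by the top
of the stack moving from `u` to `w`, while `c` stays. -/
theorem Search.Euler.push (h : σ.Inv a b n M v) (hE : σ.Euler a b M v c)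
    (hab : ∀ e < M, a e ≠ b e) (hsp : 0 < σ.sp)
    (hu : σ.st (σ.sp - 1) = u) (hl : σ.adj u = e :: l) (hused : σ.used e = 0) :
    (σ.push u e (a e + b e - u)).Euler a b M v c := by
  obtain ⟨hun, hup⟩ := h.st_lt (σ.sp - 1) (by omega)
  rw [hu] at hun hup
  obtain ⟨heM, hinc⟩ := h.adj_inc u hun e (by simp [hl])
  have hne := hab e heM
  set w := a e + b e - u with hw
  have hjo : Joins a b e u w := by unfold Joins; grind
  have hold : ∀ i < σ.sp, (σ.push u e w).st i = σ.st i := fun i hi => by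
    simp only [Search.push, Function.update_apply]; rw [if_neg (by omega)]
  have htop : (σ.push u e w).st σ.sp = w := by simp [Search.push]
  have hsp' : (σ.push u e w).sp = σ.sp + 1 := rfl
  refine ⟨?_, ?_, hE.out_zero, hE.out_adj, ?_, ?_, ?_, ?_⟩
  · intro _
    rw [hold 0 hsp]; exact hE.st_zero hsp
  · intro i hi
    rcases Nat.lt_succ_iff_lt_or_eq.1 (hsp' ▸ hi) with hlt | heq
    · rw [hold i (by omega), hold _ hlt]; exact hE.st_adj i hlt
    · have : i = σ.sp - 1 := by omega
      rw [heq, htop, hold i (by omega), this, hu]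
      exact ⟨e, heM, hjo⟩
  · intro h0; simp [Search.push] at h0
  · intro _ x
    have h1 := hE.parity hsp x
    have h2 : unusedDegree a b M σ.used x = unusedDegree a b M (σ.push u e w).used x + _ + _ :=
      unusedDegree_update heM hused x
    rw [hsp', Nat.add_sub_cancel, htop]
    rw [hu] at h1
    unfold Joins at hjo
    grind
  · intro _
    exact hE.link hsp
  · intro f hf hf0
    by_cases hfe : f = e
    · refine .inl ⟨σ.sp - 1, by omega, ?_⟩
      rw [hold _ (by omega), Nat.sub_add_cancel hsp, htop, hu, hfe]
      exact hjo
    · rcases hE.cover f hf (by simpa [Search.push, Function.update_apply, hfe] using hf0) with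
        ⟨i, hi, hj⟩ | hcase | hcase
      · refine .inl ⟨i, by omega, ?_⟩
        rwa [hold _ (by omega), hold _ (by omega)]
      · exact .inr (.inl hcase)
      · exact .inr (.inr ⟨by omega, hcase.2⟩)

/-- The heart of Hierholzer's algorithm: the trail can get stuck only at `c`, so the popped vertex
is adjacent to the end of the output (or is `v`, if the output is empty). The next stack entry then
takes the role of `c`. -/
theorem Search.Euler.pop (h : σ.Inv a b n M v) (hE : σ.Euler a b M v c) (hsp : 0 < σ.sp)
    (hu : σ.st (σ.sp - 1) = u) (hl : σ.adj u = []) :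
    (σ.pop u).Euler a b M v (σ.st (σ.sp - 2)) := by
  -- An unused edge at `u` would still be in the list of `u`, which is empty.
  have hdeg : unusedDegree a b M σ.used u = 0 := by
    refine Finset.sum_eq_zero fun e he => ?_
    split_ifs with h0 h1 h2 h2 <;> try rfl
    all_goals
      have := h.mem_adj e (Finset.mem_range.1 he) h0
      grind
  -- The unused degree `0` plus the contribution `1` of the top of the stack is odd, so `u` must
  -- also be counted as `c`.
  have huc : u = c := by
    have := hE.parity hsp u
    rw [hdeg, hu] at this
    grind
  have hold : ∀ i < σ.op, (σ.pop u).out i = σ.out i := fun i hi => by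
    simp only [Search.pop, Function.update_apply]; rw [if_neg (by omega)]
  have htop : (σ.pop u).out σ.op = u := by simp [Search.pop]
  have hop' : (σ.pop u).op = σ.op + 1 := rfl
  have hsp' : (σ.pop u).sp = σ.sp - 1 := rfl
  have hlink := hE.link hsp
  refine ⟨?_, ?_, ?_, ?_, ?_, ?_, ?_, ?_⟩
  · intro _; exact hE.st_zero hsp
  · intro i hi; exact hE.st_adj i (by omega)
  · intro _
    rcases hlink with ⟨h0, hc⟩ | ⟨hpos, -⟩
    · have := htop
      rw [h0] at this
      rw [this, huc, hc]
    · rw [hold 0 hpos]; exact hE.out_zero hpos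
  · intro i hi
    rcases Nat.lt_succ_iff_lt_or_eq.1 (hop' ▸ hi) with hlt | heq
    · rw [hold i (by omega), hold _ hlt]; exact hE.out_adj i hlt
    · rcases hlink with ⟨h0, hc⟩ | ⟨hpos, e, he, hj⟩
      · omega
      · refine ⟨e, he, ?_⟩
        rw [heq, htop, hold i (by omega), huc, show i = σ.op - 1 by omega]
        exact hj.symm
  · intro h0
    have h1 : σ.sp = 1 := by omega
    refine ⟨by omega, ?_⟩
    rw [hop', Nat.add_sub_cancel, htop, ← hu, h1]
    exact hE.st_zero hsp
  -- Before the pop `u` was both top and `c`; afterwards `st (sp - 2)` is both. In each case the two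
  -- correction terms add up to an even number.
  · intro hpos x
    have := hE.parity hsp x
    rw [hu, ← huc] at this
    have h1 : (σ.pop u).st ((σ.pop u).sp - 1) = σ.st (σ.sp - 2) := rfl
    have h2 : (σ.pop u).used = σ.used := rfl
    rw [h1, h2]
    grind
  · intro hpos
    have h3 : 1 < σ.sp := Nat.lt_of_sub_pos (hsp' ▸ hpos)
    have h2 : σ.sp - 2 + 1 = σ.sp - 1 := by clear * - h3; omega
    refine .inr ⟨by omega, ?_⟩
    obtain ⟨e, he, hj⟩ := hE.st_adj (σ.sp - 2) (by omega)
    rw [h2, hu] at hj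
    rw [hop', Nat.add_sub_cancel, htop]
    exact ⟨e, he, hj⟩
  · intro f hf hf0
    rcases hE.cover f hf hf0 with ⟨i, hi, hj⟩ | ⟨i, hi, hj⟩ | ⟨-, hpos, hj⟩
    -- The topmost stack edge becomes the link between stack and output, and in the last case the
    -- former link becomes an edge of the output.
    · by_cases hii : i + 1 = σ.sp - 1
      · refine .inr (.inr ⟨by omega, by omega, ?_⟩)
        rw [hop', Nat.add_sub_cancel, htop, ← hu, ← hii, show σ.sp - 2 = i by omega]
        exact hj
      · exact .inl ⟨i, by omega, hj⟩
    · refine .inr (.inl ⟨i, by omega, ?_⟩)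
      rwa [hold _ (by omega), hold _ (by omega)]
    · refine .inr (.inl ⟨σ.op - 1, by omega, ?_⟩)
      rw [Nat.sub_add_cancel hpos, htop, hold _ (by omega), huc]
      exact hj.symm

/-- `(a, b)` is connected on `{0, …, n - 1}`. -/
def IsConn (a b : ℕ → ℕ) (n M : ℕ) (v : ℕ) : Prop :=
  ∀ P : ℕ → Prop, P v → (∀ e < M, P (a e) ↔ P (b e)) → ∀ x < n, P x

/-- Once the stack is empty, each reached vertex is in the output and so has an empty list, hence
all its edges are used. Then the set of reached vertices is closed under adjacency and connectivity
applies. -/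
theorem Search.Inv.par_ne_zero (h : σ.Inv a b n M v) (hab : ∀ e < M, a e < n ∧ b e < n)
    (hconn : IsConn a b n M v) (hsp : σ.sp = 0) :
    (∀ x < n, σ.par x ≠ 0) ∧ ∀ e < M, σ.used e ≠ 0 := by
  have hmem : ∀ x < n, σ.par x ≠ 0 → σ.adj x = [] := by
    intro x hx hp
    rcases h.visited x hx hp with ⟨i, hi, -⟩ | ⟨i, hi, rfl⟩
    · omega
    · exact (h.out_lt i hi).2
  have hu : ∀ e < M, (σ.par (a e) ≠ 0 ∨ σ.par (b e) ≠ 0) → σ.used e ≠ 0 := by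
    intro e he hor h0
    have h1 := h.mem_adj e he h0
    have h2 := hab e he
    rcases hor with hor | hor
    · rw [hmem _ h2.1 hor] at h1; simp at h1
    · rw [hmem _ h2.2 hor] at h1; simp at h1
  have hall : ∀ x < n, σ.par x ≠ 0 := by
    refine hconn _ (by rw [h.tree.par_root]; omega) fun e he => ⟨fun hp => ?_, fun hp => ?_⟩
    · exact (h.par_of_used e he (hu e he (.inl hp))).2
    · exact (h.par_of_used e he (hu e he (.inr hp))).1
  exact ⟨hall, fun e he => hu e he (.inl (hall _ (hab e he).1))⟩

end Search

/-! ## Trail search: the program -/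

/-- The linked list with head `h`, successors `nxt` and entries `ed`, all of whose nodes are numbered
below `N`, is `l`. Pointers are node numbers plus one, or `0` at the end of the list. -/
def Chain (nxt ed : ℕ → ℕ) (N : ℕ) : ℕ → List ℕ → Prop
  | h, [] => h = 0
  | h, e :: l => 0 < h ∧ h - 1 < N ∧ ed (h - 1) = e ∧ Chain nxt ed N (nxt (h - 1)) l

theorem Chain.congr {nxt ed nxt' ed' : ℕ → ℕ} {N N' : ℕ} (hN : N ≤ N')
    (hn : ∀ i < N, nxt' i = nxt i) (he : ∀ i < N, ed' i = ed i) {h : ℕ} {l : List ℕ}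
    (hc : Chain nxt ed N h l) : Chain nxt' ed' N' h l := by
  induction l generalizing h with
  | nil => exact hc
  | cons e l ih =>
    obtain ⟨h1, h2, h3, h4⟩ := hc
    exact ⟨h1, by omega, by rw [he _ h2, h3], by rw [hn _ h2]; exact ih h4⟩

theorem Chain.le {nxt ed : ℕ → ℕ} {N h : ℕ} {l : List ℕ} (hc : Chain nxt ed N h l) : h ≤ N := by
  cases l with
  | nil => have : h = 0 := hc; omega
  | cons e l => have := hc.2.1; omega

/-- The linked lists with heads `hd u`, for `u < n`, are `adj u`, and have `N` nodes altogether. -/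
structure Lists (nxt ed hd : ℕ → ℕ) (n N : ℕ) (adj : ℕ → List ℕ) : Prop where
  chain : ∀ u < n, Chain nxt ed N (hd u) (adj u)
  sum : ∑ u ∈ Finset.range n, (adj u).length = N

-- The node `N` is fresh, so writing it does not disturb the existing chains.
open Function in
theorem Lists.cons {nxt ed hd : ℕ → ℕ} {n N : ℕ} {adj : ℕ → List ℕ} (h : Lists nxt ed hd n N adj)
    {u : ℕ} (hu : u < n) (e : ℕ) :
    Lists (update nxt N (hd u)) (update ed N e) (update hd u (N + 1)) n (N + 1)
      (update adj u (e :: adj u)) := by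
  have hc : ∀ x < n, Chain (update nxt N (hd u)) (update ed N e) (N + 1) (hd x) (adj x) :=
    fun x hx => (h.chain x hx).congr (by omega)
      (fun i hi => by rw [update_apply, if_neg (by omega)])
      (fun i hi => by rw [update_apply, if_neg (by omega)])
  refine ⟨fun x hx => ?_, ?_⟩
  · by_cases hxu : x = u
    · subst hxu
      rw [update_self, update_self]
      exact ⟨by omega, by omega, by simp, by simpa using hc x hx⟩
    · rw [update_of_ne hxu, update_of_ne hxu]
      exact hc x hx
  · have h1 : ∀ x, (update adj u (e :: adj u) x).length
        = (adj x).length + if x = u then 1 else 0 := by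
      intro x
      by_cases hxu : x = u
      · subst hxu; simp
      · simp [hxu]
    simp only [h1, Finset.sum_add_distrib, h.sum]
    simp [hu]

/-- The total length of the lists is the main part of the measure that bounds the number of search
steps. -/
theorem sum_length_tail {n u e : ℕ} {adj : ℕ → List ℕ} {l : List ℕ} (hu : u < n)
    (hl : adj u = e :: l) :
    ∑ x ∈ Finset.range n, (adj x).length =
      ∑ x ∈ Finset.range n, (Function.update adj u (adj u).tail x).length + 1 := by
  have h1 : ∀ x, (adj x).length
      = (Function.update adj u (adj u).tail x).length + if x = u then 1 else 0 := by
    intro x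
    by_cases hxu : x = u
    · subst hxu; simp [hl]
    · simp [hxu]
  simp only [h1, Finset.sum_add_distrib]
  simp [hu]

infixr:60 " ;; " => Prog.seq

/-- Clear the list heads and the parents. -/
def clearVertices : Prog :=
  .assign 4 (.lit 0) ;;
  .whileLt (.reg 4) (.reg 0)
    (.store 4 (.reg 4) (.lit 0) ;; .store 11 (.reg 4) (.lit 0) ;;
      .assign 4 (.add (.reg 4) (.lit 1)))

/-- Prepend the edge in register `4` to the list of its endpoint in array `x`. -/
def addNode (x : ℕ) : Prog :=
  .assign 5 (.get x (.reg 4)) ;; .store 5 (.reg 6) (.get 4 (.reg 5)) ;;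
  .store 7 (.reg 6) (.reg 4) ;; .assign 6 (.add (.reg 6) (.lit 1)) ;; .store 4 (.reg 5) (.reg 6)

/-- Build the adjacency lists and mark all edges as unused. -/
def buildLists : Prog :=
  .assign 4 (.lit 0) ;; .assign 6 (.lit 0) ;;
  .whileLt (.reg 4) (.reg 1)
    (.store 8 (.reg 4) (.lit 0) ;; addNode 0 ;; addNode 1 ;;
      .assign 4 (.add (.reg 4) (.lit 1)))

/-- Put the initial vertex on the stack and make it the root of the tree. -/
def startSearch : Prog :=
  .assign 8 (.lit 1) ;; .store 9 (.lit 0) (.reg 2) ;; .assign 9 (.lit 0) ;;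
  .store 11 (.reg 2) (.add (.reg 2) (.lit 1)) ;; .store 12 (.reg 2) (.lit 0) ;;
  .store 13 (.lit 0) (.reg 2) ;; .assign 10 (.lit 1)

/-- One step of the search. -/
def searchStep : Prog :=
  .assign 5 (.get 9 (.sub (.reg 8) (.lit 1))) ;;
  .assign 6 (.get 4 (.reg 5)) ;;
  .ifLt (.lit 0) (.reg 6)
    (.assign 7 (.get 7 (.sub (.reg 6) (.lit 1))) ;;
      .store 4 (.reg 5) (.get 5 (.sub (.reg 6) (.lit 1))) ;;
      .ifLt (.lit 0) (.get 8 (.reg 7)) .skip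
        (.store 8 (.reg 7) (.lit 1) ;;
          .assign 11 (.sub (.add (.get 0 (.reg 7)) (.get 1 (.reg 7))) (.reg 5)) ;;
          .store 9 (.reg 8) (.reg 11) ;;
          .assign 8 (.add (.reg 8) (.lit 1)) ;;
          .ifLt (.lit 0) (.get 11 (.reg 11)) .skip
            (.store 11 (.reg 11) (.add (.reg 5) (.lit 1)) ;;
              .store 12 (.reg 11) (.add (.get 12 (.reg 5)) (.lit 1)) ;;
              .store 13 (.reg 10) (.reg 11) ;;
              .assign 10 (.add (.reg 10) (.lit 1)))))
    (.store 10 (.reg 9) (.reg 5) ;; .assign 9 (.add (.reg 9) (.lit 1)) ;;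
      .assign 8 (.sub (.reg 8) (.lit 1)))

/-- The search: compute a spanning tree and, if all degrees are even, an Euler tour. -/
def search : Prog :=
  clearVertices ;; buildLists ;; startSearch ;; .whileLt (.lit 0) (.reg 8) searchStep

/-- The search is run twice, so its arrays cannot be assumed to be zero at the start. -/
theorem runs_clearVertices {W : ℕ} {s : State} (hW : s.reg 0 + 1 ≤ W) :
    Runs W clearVertices s (2 + (s.reg 0 + 1) * 14)
      fun s' => ∀ x < s.reg 0, s'.arr 4 x = 0 ∧ s'.arr 11 x = 0 := by
  refine Runs.seq (Runs.of_wp_le (T := 2) (c := .assign 4 (.lit 0)) (Q := fun s' => s'.reg 4 = 0) (by decide) ?_)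
    fun s₁ hF h4 => ?_
  · simp [Prog.wp, Expr.Fits, Expr.eval, State.setReg_reg]
  have h0 : s₁.reg 0 = s.reg 0 := hF.1 0 rfl
  refine (Runs.while (T := 11) (m := s.reg 0) (fun m s' => s'.reg 4 + m = s.reg 0 ∧
    ∀ x < s'.reg 4, s'.arr 4 x = 0 ∧ s'.arr 11 x = 0) ⟨by omega, by omega⟩ ?_).mono ?_ ?_
  · rintro m s' hF' ⟨hm, hz⟩
    have h0' : s'.reg 0 = s.reg 0 := (hF'.1 0 rfl).trans h0
    refine ⟨by simp only [Expr.Fits]; omega, by simp only [Expr.Fits]; omega, fun hlt => ?_⟩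
    simp only [Expr.eval] at hlt
    refine Runs.of_wp_le (by decide) ?_
    simp only [Prog.wp, Expr.Fits, Expr.eval, State.setReg_reg, State.setReg_arr, State.setArr_reg,
      State.setArr_arr, Nat.reduceEqDiff, reduceIte]
    refine ⟨by omega, by omega, by omega, by omega, by omega, m - 1, by omega, by omega, ?_⟩
    intro x hx
    have := hz x
    simp only [Function.update_apply]
    grind
  · simp [Expr.cost]
  · rintro s' hF' ⟨⟨m, hm, hz⟩, hlt⟩
    have h0' : s'.reg 0 = s.reg 0 := (hF'.1 0 rfl).trans h0
    simp only [Expr.eval] at hlt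
    exact fun x hx => hz x (by omega)

/-- The continuation form allows the two calls in the body of the loop to be chained without
unfolding `addNode` again. -/
theorem wp_addNode {W x N : ℕ} {s : State} {Q : State → Prop} {adj : ℕ → List ℕ} {n : ℕ}
    (h : Lists (s.arr 5) (s.arr 7) (s.arr 4) n N adj) (h6 : s.reg 6 = N)
    (hx : s.arr x (s.reg 4) < n) (hn : n ≤ W) (hN : N + 1 ≤ W) (h4 : s.reg 4 ≤ W)
    (hQ : ∀ s', Lists (s'.arr 5) (s'.arr 7) (s'.arr 4) n (N + 1)
        (Function.update adj (s.arr x (s.reg 4)) (s.reg 4 :: adj (s.arr x (s.reg 4)))) →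
      s'.reg 6 = N + 1 → s'.reg 4 = s.reg 4 → Frame (addNode x) s s' → Q s') :
    (addNode x).wp W Q s := by
  have hle := (h.chain _ hx).le
  have hfr : ∀ s', (∀ r, r ≠ 5 → r ≠ 6 → s'.reg r = s.reg r) →
      (∀ r, r ≠ 5 → r ≠ 7 → r ≠ 4 → s'.arr r = s.arr r) → Frame (addNode x) s s' := by
    intro s' h1 h2
    refine ⟨fun r hr => h1 r ?_ ?_, fun r hr => h2 r ?_ ?_ ?_⟩ <;>
    · rintro rfl
      simp [addNode, Prog.writesReg, Prog.writesArr] at hr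
  simp only [addNode, Prog.wp, Expr.Fits, Expr.eval, State.setReg_reg, State.setReg_arr,
    State.setArr_reg, Nat.reduceEqDiff, reduceIte]
  refine ⟨by omega, by omega, by omega, by omega, by omega, by omega, by omega, by omega, ?_⟩
  refine hQ _ ?_ ?_ ?_ (hfr _ ?_ ?_)
  · simpa [State.setReg_reg, State.setReg_arr, State.setArr_reg, State.setArr_arr, h6]
      using h.cons hx (s.reg 4)
  · simp [State.setReg_reg, State.setArr_reg, h6]
  · simp [State.setReg_reg, State.setArr_reg]
  · intro r h5 h6
    simp [State.setReg_reg, State.setArr_reg, h5, h6]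
  · intro r h5 h7 h4
    simp [State.setReg_arr, State.setArr_arr, h5, h7, h4]

theorem runs_buildLists {W n M : ℕ} {s : State} (hM : s.reg 1 = M)
    (hab : ∀ e < M, s.arr 0 e < n ∧ s.arr 1 e < n) (h4 : ∀ x < n, s.arr 4 x = 0)
    (hW : n + 2 * M + 1 ≤ W) :
    Runs W buildLists s (2 + (2 + (M + 1) * 44)) fun s' => (∀ e < M, s'.arr 8 e = 0) ∧
      ∃ adj, Lists (s'.arr 5) (s'.arr 7) (s'.arr 4) n (2 * M) adj ∧
        ∀ u < n, ∀ e, e ∈ adj u ↔ e < M ∧ (s.arr 0 e = u ∨ s.arr 1 e = u) := by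
  refine Runs.seq (Runs.of_wp_le (T := 2) (c := .assign 4 (.lit 0)) (Q := fun s' => s'.reg 4 = 0) (by decide) ?_)
    fun s₁ hF₁ h4₁ => ?_
  · simp [Prog.wp, Expr.Fits, Expr.eval, State.setReg_reg]
  refine (Runs.seq (Runs.of_wp_le (T := 2) (c := .assign 6 (.lit 0)) (Q := fun s' => s'.reg 6 = 0) (by decide) ?_)
    fun s₂ hF₂ h6₂ => Runs.while (T := 41) (m := M) (fun m s' => s'.reg 4 + m = M ∧
      -- Each edge creates two list nodes, one per endpoint.
      s'.reg 6 = 2 * s'.reg 4 ∧ (∀ e < s'.reg 4, s'.arr 8 e = 0) ∧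
      ∃ adj, Lists (s'.arr 5) (s'.arr 7) (s'.arr 4) n (2 * s'.reg 4) adj ∧
        ∀ u < n, ∀ e, e ∈ adj u ↔ e < s'.reg 4 ∧ (s.arr 0 e = u ∨ s.arr 1 e = u)) ?_ ?_).mono
    (T' := 2 + (M + 1) * 44) ?_ ?_
  · simp [Prog.wp, Expr.Fits, Expr.eval, State.setReg_reg]
  · have h42 : s₂.reg 4 = 0 := (hF₂.1 4 rfl).trans h4₁
    have h4a : s₂.arr 4 = s.arr 4 := (hF₂.2 4 rfl).trans (hF₁.2 4 rfl)
    refine ⟨by omega, by omega, by omega, fun _ => [], ⟨fun u hu => ?_, by simp [h42]⟩,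
      by simp [h42]⟩
    rw [h4a]; exact h4 u hu
  · rintro m s' hF' ⟨hm, h6, h8, adj, hL, hadj⟩
    have h1' : s'.reg 1 = M := (hF'.1 1 rfl).trans ((hF₂.1 1 rfl).trans ((hF₁.1 1 rfl).trans hM))
    have ha0 : s'.arr 0 = s.arr 0 := (hF'.2 0 rfl).trans ((hF₂.2 0 rfl).trans (hF₁.2 0 rfl))
    have ha1 : s'.arr 1 = s.arr 1 := (hF'.2 1 rfl).trans ((hF₂.2 1 rfl).trans (hF₁.2 1 rfl))
    refine ⟨by simp only [Expr.Fits]; omega, by simp only [Expr.Fits]; omega, fun hlt => ?_⟩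
    simp only [Expr.eval, h1'] at hlt
    obtain ⟨hx0, hx1⟩ := hab _ hlt
    refine Runs.of_wp_le (by decide) ?_
    rw [Prog.wp, Prog.wp]
    refine ⟨by simp only [Expr.Fits]; omega, by simp only [Expr.Fits]; omega, ?_⟩
    rw [Prog.wp]
    refine wp_addNode (N := 2 * s'.reg 4) (n := n) (adj := adj) ?_ ?_ ?_ (by omega) (by omega) ?_ ?_
    · simpa [State.setArr_arr] using hL
    · simpa [State.setArr_reg] using h6
    · simpa [State.setArr_arr, State.setArr_reg, Expr.eval, ha0] using hx0
    · simp only [State.setArr_reg]; omega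
    intro t hL₁ ht6 ht4 htF
    simp only [State.setArr_arr, State.setArr_reg, Nat.reduceEqDiff, reduceIte, ha0] at hL₁ ht4
    have ht0 : t.arr 1 = s.arr 1 := by
      rw [htF.2 1 rfl]; simp [State.setArr_arr, ha1]
    have ht8 : t.arr 8 = Function.update (s'.arr 8) (s'.reg 4) 0 := by
      rw [htF.2 8 rfl]; simp [State.setArr_arr, Expr.eval]
    rw [Prog.wp]
    refine wp_addNode hL₁ ht6 ?_ (by omega) (by omega) (by omega) ?_
    · rw [ht0, ht4]; exact hx1
    intro t' hL₂ ht6' ht4' htF'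
    have ht8' : t'.arr 8 = t.arr 8 := htF'.2 8 rfl
    rw [ht0, ht4] at hL₂
    simp only [Prog.wp, Expr.Fits, Expr.eval, State.setReg_reg, State.setReg_arr, reduceIte,
      Nat.reduceEqDiff]
    refine ⟨by omega, m - 1, by omega, by omega, by omega, ?_, _,
      (show 2 * (t'.reg 4 + 1) = 2 * s'.reg 4 + 1 + 1 by omega) ▸ hL₂, ?_⟩
    · intro e he
      rw [ht8', ht8, Function.update_apply]
      have := h8 e
      grind
    · intro u hu e
      have h1 := hadj u hu e
      have h2 := hadj (s.arr 0 (s'.reg 4)) hx0 e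
      have h3 := hadj (s.arr 1 (s'.reg 4)) hx1 e
      simp only [Function.update_apply]
      rw [ht4', ht4]
      grind
  · simp [Expr.cost]
  · rintro s' hF' ⟨⟨m, hm, h6, h8, adj, hL, hadj⟩, hlt⟩
    have h1' : s'.reg 1 = M := (hF'.1 1 rfl).trans ((hF₁.1 1 rfl).trans hM)
    simp only [Expr.eval] at hlt
    have : s'.reg 4 = M := by omega
    rw [this] at h8 hL hadj
    exact ⟨h8, adj, hL, hadj⟩

/-- The abstract search state stored in memory, where `adj` are the edges still to be examined. -/
def State.search (s : State) (adj : ℕ → List ℕ) : Search where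
  adj := adj
  used := s.arr 8
  st := s.arr 9
  sp := s.reg 8
  out := s.arr 10
  op := s.reg 9
  par := s.arr 11
  dep := s.arr 12
  ord := s.arr 13
  cnt := s.reg 10

theorem Lists.chain_tail {nxt ed hd : ℕ → ℕ} {n N u e : ℕ} {adj : ℕ → List ℕ} {l : List ℕ}
    (h : ∀ x < n, Chain nxt ed N (hd x) (adj x)) (hu : u < n) (hl : adj u = e :: l) :
    ∀ x < n, Chain nxt ed N (Function.update hd u (nxt (hd u - 1)) x)
      (Function.update adj u (adj u).tail x) := by
  intro x hx
  by_cases hxu : x = u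
  · subst hxu
    have := h x hx
    rw [hl] at this
    simpa [hl] using this.2.2.2
  · rw [Function.update_of_ne hxu, Function.update_of_ne hxu]
    exact h x hx

theorem Search.Inv.sum_used_le {a b : ℕ → ℕ} {n M v : ℕ} {σ : Search} (h : σ.Inv a b n M v) :
    ∑ e ∈ Finset.range M, σ.used e ≤ M := by
  have := Finset.sum_le_card_nsmul (Finset.range M) σ.used 1
    fun e he => h.used_le e (Finset.mem_range.1 he)
  simpa using this

/-- The link between program and abstract algorithm: each path through the code is `drop`, `push` or
`pop` on the state stored in memory. The lists `adj` are ghost data; memory holds only the chains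
representing them. -/
theorem wp_searchStep {W n M v N : ℕ} {s : State} {Q : State → Prop} {adj : ℕ → List ℕ}
    (hW : 2 * n + 2 * M + 3 ≤ W) (hN : N ≤ 2 * M)
    (hab : ∀ e < M, s.arr 0 e < n ∧ s.arr 1 e < n)
    (h : (s.search adj).Inv (s.arr 0) (s.arr 1) n M v)
    (hch : ∀ u < n, Chain (s.arr 5) (s.arr 7) N (s.arr 4 u) (adj u)) (hsp : 0 < s.reg 8)
    (hdrop : ∀ u e l s', u < n → adj u = e :: l → s.arr 8 e ≠ 0 →
      s'.search (Function.update adj u (adj u).tail) = (s.search adj).drop u →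
      s'.arr 4 = Function.update (s.arr 4) u (s.arr 5 (s.arr 4 u - 1)) →
      Frame searchStep s s' → Q s')
    (hpush : ∀ u e l s', u < n → adj u = e :: l → s.arr 8 e = 0 → s.arr 9 (s.reg 8 - 1) = u →
      s'.search (Function.update adj u (adj u).tail) =
        (s.search adj).push u e (s.arr 0 e + s.arr 1 e - u) →
      s'.arr 4 = Function.update (s.arr 4) u (s.arr 5 (s.arr 4 u - 1)) →
      Frame searchStep s s' → Q s')
    (hpop : ∀ u s', u < n → adj u = [] → s.arr 9 (s.reg 8 - 1) = u →
      s'.search adj = (s.search adj).pop u → s'.arr 4 = s.arr 4 →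
      Frame searchStep s s' → Q s') :
    searchStep.wp W Q s := by
  have hfr : ∀ s', (∀ r, searchStep.writesReg r = false → s'.reg r = s.reg r) →
      (∀ r, searchStep.writesArr r = false → s'.arr r = s.arr r) → Frame searchStep s s' :=
    fun s' h1 h2 => ⟨h1, h2⟩
  -- These three facts bound the stack and output pointers by `M + 1` and the tree counter by `n`,
  -- so that all addresses fit.
  have hcnt := h.count
  have hcl := h.tree.cnt_le
  have hcard := h.sum_used_le
  simp only [State.search] at hcnt hcl hcard
  obtain ⟨hun, hup⟩ := h.st_lt (s.reg 8 - 1) (by simp only [State.search]; omega)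
  simp only [State.search] at hun hup
  obtain ⟨u, hu⟩ : ∃ u, s.arr 9 (s.reg 8 - 1) = u := ⟨_, rfl⟩
  rw [hu] at hun hup
  have hcu := hch u hun
  have hhd := hcu.le
  have hdu : s.arr 12 u < n := h.tree.dep_lt hun hup
  unfold searchStep
  simp only [Prog.wp, Expr.Fits, Expr.eval, State.setReg_reg, State.setReg_arr, State.setArr_reg,
    State.setArr_arr, Nat.reduceEqDiff, reduceIte, hu]
  refine ⟨by omega, by omega, by omega, by omega, fun hpos => ?_, fun hnpos => ?_⟩
  · obtain ⟨e, l, hl⟩ : ∃ e l, adj u = e :: l := by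
      rcases hadj : adj u with _ | ⟨e, l⟩
      · rw [hadj] at hcu; have : s.arr 4 u = 0 := hcu; omega
      · exact ⟨e, l, rfl⟩
    obtain ⟨heM, hinc⟩ := h.adj_inc u hun e (by simp [State.search, hl])
    obtain ⟨hae, hbe⟩ := hab e heM
    rw [hl] at hcu
    obtain ⟨-, hlt, hed, htl⟩ := hcu
    have hle := htl.le
    have hue : s.arr 8 e ≤ 1 := h.used_le e heM
    set w := s.arr 0 e + s.arr 1 e - u with hw
    have hwn : w < n := by omega
    have hpw : s.arr 11 w ≤ n := h.tree.par_le hwn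
    simp only [hed, ← hw]
    refine ⟨by omega, by omega, by omega, by omega, by omega, fun h8 => ?_, fun h8 => ?_⟩
    · refine hdrop u e l _ hun hl (by omega) ?_ ?_ (hfr _ ?_ ?_)
      · simp [State.search, Search.drop, State.setReg_reg, State.setReg_arr, State.setArr_reg,
          State.setArr_arr]
      · simp [State.setReg_arr, State.setArr_arr]
      · intro r hr
        simp only [searchStep, Prog.writesReg, Bool.or_eq_false_iff, beq_eq_false_iff_ne] at hr
        simp [State.setReg_reg, State.setArr_reg, hr]
      · intro r hr
        simp only [searchStep, Prog.writesArr, Bool.or_eq_false_iff, beq_eq_false_iff_ne] at hr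
        simp [State.setReg_arr, State.setArr_arr, hr]
    · have h0 : s.arr 8 e = 0 := by omega
      refine ⟨by omega, by omega, by omega, by omega, by omega, by omega, by omega, by omega,
        fun hp => ?_, fun hp => ?_⟩
      · refine hpush u e l _ hun hl h0 hu ?_ ?_ (hfr _ ?_ ?_)
        · have hp0 : s.arr 11 w ≠ 0 := by omega
          simp [State.search, Search.push, State.setReg_reg, State.setReg_arr, State.setArr_reg,
            State.setArr_arr, ← hw, hp0]
        · simp [State.setReg_arr, State.setArr_arr]
        · intro r hr
          simp only [searchStep, Prog.writesReg, Bool.or_eq_false_iff, beq_eq_false_iff_ne] at hr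
          simp [State.setReg_reg, State.setArr_reg, hr]
        · intro r hr
          simp only [searchStep, Prog.writesArr, Bool.or_eq_false_iff, beq_eq_false_iff_ne] at hr
          simp [State.setReg_arr, State.setArr_arr, hr]
      · refine ⟨by omega, by omega, by omega, by omega, by omega, by omega, by omega, ?_⟩
        refine hpush u e l _ hun hl h0 hu ?_ ?_ (hfr _ ?_ ?_)
        · have hp0 : s.arr 11 w = 0 := by omega
          simp [State.search, Search.push, State.setReg_reg, State.setReg_arr, State.setArr_reg,
            State.setArr_arr, ← hw, hp0]
        · simp [State.setReg_arr, State.setArr_arr]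
        · intro r hr
          simp only [searchStep, Prog.writesReg, Bool.or_eq_false_iff, beq_eq_false_iff_ne] at hr
          simp [State.setReg_reg, State.setArr_reg, hr]
        · intro r hr
          simp only [searchStep, Prog.writesArr, Bool.or_eq_false_iff, beq_eq_false_iff_ne] at hr
          simp [State.setReg_arr, State.setArr_arr, hr]
  · refine ⟨by omega, by omega, by omega, by omega, ?_⟩
    have hnil : adj u = [] := by
      rcases hadj : adj u with _ | ⟨e, l⟩
      · rfl
      · rw [hadj] at hcu; have := hcu.1; omega
    refine hpop u _ hun hnil hu ?_ ?_ (hfr _ ?_ ?_)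
    · simp [State.search, Search.pop, State.setReg_reg, State.setReg_arr, State.setArr_reg,
        State.setArr_arr]
    · simp [State.setReg_arr, State.setArr_arr]
    · intro r hr
      simp only [searchStep, Prog.writesReg, Bool.or_eq_false_iff, beq_eq_false_iff_ne] at hr
      simp [State.setReg_reg, State.setArr_reg, hr]
    · intro r hr
      simp only [searchStep, Prog.writesArr, Bool.or_eq_false_iff, beq_eq_false_iff_ne] at hr
      simp [State.setReg_arr, State.setArr_arr, hr]

/-- All degrees are even. -/
def IsEven (a b : ℕ → ℕ) (M : ℕ) : Prop := ∀ x, unusedDegree a b M (fun _ => 0) x % 2 = 0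

/-- `out` is the vertex sequence of a closed trail of length `M` from `v` through all edges. -/
structure IsTour (a b : ℕ → ℕ) (M v : ℕ) (out : ℕ → ℕ) : Prop where
  first : out 0 = v
  last : out M = v
  adj : ∀ i < M, ∃ e < M, Joins a b e (out i) (out (i + 1))
  cover : ∀ e < M, ∃ i < M, Joins a b e (out i) (out (i + 1))

theorem Search.Inv.isTour {a b : ℕ → ℕ} {n M v c : ℕ} {σ : Search} (h : σ.Inv a b n M v)
    (hE : σ.Euler a b M v c) (hab : ∀ e < M, a e < n ∧ b e < n) (hconn : IsConn a b n M v)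
    (hsp : σ.sp = 0) : IsTour a b M v σ.out := by
  obtain ⟨-, hu⟩ := h.par_ne_zero hab hconn hsp
  -- All `M` edges are used and the stack is empty, so `count` leaves `M + 1` vertices in the
  -- output.
  have hop : σ.op = M + 1 := by
    have h1 := h.count
    have h2 : ∑ e ∈ Finset.range M, σ.used e = M := by
      rw [Finset.sum_congr rfl (g := fun _ => 1)]
      · simp
      · intro e he
        have := hu e (Finset.mem_range.1 he)
        have := h.used_le e (Finset.mem_range.1 he)
        omega
    omega
  refine ⟨hE.out_zero (by omega), ?_, fun i hi => hE.out_adj i (by omega), fun e he => ?_⟩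
  · have := (hE.final hsp).2
    rwa [hop] at this
  · rcases hE.cover e he (hu e he) with ⟨i, hi, -⟩ | ⟨i, hi, hj⟩ | ⟨h0, -⟩
    · omega
    · exact ⟨i, by omega, hj⟩
    · omega

theorem runs_search {W n M v : ℕ} {s : State} (h0 : s.reg 0 = n) (h1 : s.reg 1 = M)
    (h2 : s.reg 2 = v) (hv : v < n)
    (hab : ∀ e < M, s.arr 0 e < n ∧ s.arr 1 e < n ∧ s.arr 0 e ≠ s.arr 1 e)
    (hconn : IsConn (s.arr 0) (s.arr 1) n M v) (hW : 2 * n + 2 * M + 3 ≤ W) :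
    Runs W search s (1000 * (n + M + 1)) fun s' =>
      IsTree (s.arr 0) (s.arr 1) n M v (s'.arr 11) (s'.arr 12) (s'.arr 13) (s'.reg 10) ∧
      (∀ x < n, s'.arr 11 x ≠ 0) ∧
      (IsEven (s.arr 0) (s.arr 1) M → IsTour (s.arr 0) (s.arr 1) M v (s'.arr 10)) := by
  have hab' : ∀ e < M, s.arr 0 e < n ∧ s.arr 1 e < n := fun e he => ⟨(hab e he).1, (hab e he).2.1⟩
  refine (Runs.seq (runs_clearVertices (by omega)) fun s₁ hF₁ hz => Runs.seq (runs_buildLists (n := n)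
    ((hF₁.1 1 rfl).trans h1) ?_ ?_ (by omega)) fun s₂ hF₂ ⟨h8, adj₀, hL, hadj⟩ =>
    Runs.seq (Runs.of_wp_le (T := 20) (by decide) (Q := fun s₃ =>
      s₃.search adj₀ = ⟨adj₀, s₂.arr 8, Function.update (s₂.arr 9) 0 v, 1, s₂.arr 10, 0,
        Function.update (s₂.arr 11) v (v + 1), Function.update (s₂.arr 12) v 0,
        Function.update (s₂.arr 13) 0 v, 1⟩) ?_) fun s₃ hF₃ hs₃ =>
    -- The measure is twice the number of list nodes plus the stack height: `drop` lowers it by two,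
    -- `push` by two less the one new stack entry, `pop` by one. Initially there are `2 * M` nodes
    -- and one stack entry.
    Runs.while (T := 100) (m := 4 * M + 1) (fun m s' => ∃ adj,
      (s'.search adj).Inv (s.arr 0) (s.arr 1) n M v ∧
      (IsEven (s.arr 0) (s.arr 1) M → ∃ c, (s'.search adj).Euler (s.arr 0) (s.arr 1) M v c) ∧
      (∀ u < n, Chain (s'.arr 5) (s'.arr 7) (2 * M) (s'.arr 4 u) (adj u)) ∧
      m = 2 * ∑ u ∈ Finset.range n, (adj u).length + s'.reg 8) ?_ ?_).mono ?_ ?_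
  · rw [hF₁.2 0 rfl, hF₁.2 1 rfl]; exact hab'
  · intro x hx; exact (hz x (by omega)).1
  · have h22 : s₂.reg 2 = v := (hF₂.1 2 rfl).trans ((hF₁.1 2 rfl).trans h2)
    simp only [startSearch, Prog.wp, Expr.Fits, Expr.eval, State.setReg_reg,
      State.setArr_reg, Nat.reduceEqDiff, reduceIte]
    refine ⟨by omega, by omega, by omega, by omega, by omega, by omega, by omega, by omega, by omega,
      by omega, by omega, ?_⟩
    simp [State.search, State.setReg_reg, State.setReg_arr, State.setArr_reg, State.setArr_arr, h22]
  · have h11 : ∀ x < n, s₂.arr 11 x = 0 := fun x hx => by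
      rw [hF₂.2 11 rfl]; exact (hz x (by omega)).2
    have hse : s₃.reg 8 = 1 := congrArg Search.sp hs₃
    have a0 : s₁.arr 0 = s.arr 0 := hF₁.2 0 rfl
    have a1 : s₁.arr 1 = s.arr 1 := hF₁.2 1 rfl
    rw [a0, a1] at hadj
    -- At the start both the top of the stack and `c` are `v`, so the two parity corrections cancel
    -- modulo two.
    refine ⟨adj₀, ?_, fun hev => ⟨v, ?_⟩, ?_, ?_⟩
    · rw [hs₃]
      refine ⟨⟨one_pos, by simp, by simp, by simp, ?_, ?_, ?_, ?_⟩, ?_, ?_, ?_, ?_, ?_, ?_, ?_, ?_⟩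
      · intro i hi
        dsimp only at hi
        have : i = 0 := by omega
        subst this
        simpa using hv
      · intro x hx hp
        by_cases hxv : x = v
        · exact ⟨0, one_pos, by simp [hxv]⟩
        · simp only [Function.update_of_ne hxv] at hp
          exact absurd (h11 x hx) hp
      · intro i hi j hj _; dsimp only at hi hj; omega
      · intro i hi hi'; dsimp only at hi; omega
      · intro u hu e he
        exact (hadj u hu e).1 he
      · intro e he _
        exact ⟨(hadj _ (hab e he).1 e).2 ⟨he, .inl rfl⟩, (hadj _ (hab e he).2.1 e).2 ⟨he, .inr rfl⟩⟩
      · intro e he; simp only [h8 e he]; omega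
      · intro e he hne; exact absurd (h8 e he) hne
      · intro i hi
        simp only at hi
        have : i = 0 := by omega
        subst this
        simpa using hv
      · intro i hi; simp at hi
      · intro x hx hp
        by_cases hxv : x = v
        · exact .inl ⟨0, one_pos, by simp [hxv]⟩
        · simp only [Function.update_of_ne hxv] at hp
          exact absurd (h11 x hx) hp
      · simp only
        rw [Finset.sum_eq_zero fun e he => h8 e (Finset.mem_range.1 he)]
    · rw [hs₃]
      refine ⟨by simp, by simp, by simp, by simp, by simp, ?_, by simp, ?_⟩
      · intro _ x
        have hd : unusedDegree (s.arr 0) (s.arr 1) M (s₂.arr 8) x =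
            unusedDegree (s.arr 0) (s.arr 1) M (fun _ => 0) x :=
          Finset.sum_congr rfl fun e he => by simp [h8 e (Finset.mem_range.1 he)]
        have := hev x
        simp only [hd]
        grind
      · intro e he hne; exact absurd (h8 e he) hne
    · rw [hF₃.2 4 rfl, hF₃.2 5 rfl, hF₃.2 7 rfl]
      exact hL.chain
    · rw [hL.sum, hse]; omega
  · rintro m s' hF' ⟨adj, hI, hE, hch, hm⟩
    have a0 : s'.arr 0 = s.arr 0 :=
      (hF'.2 0 rfl).trans ((hF₃.2 0 rfl).trans ((hF₂.2 0 rfl).trans (hF₁.2 0 rfl)))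
    have a1 : s'.arr 1 = s.arr 1 :=
      (hF'.2 1 rfl).trans ((hF₃.2 1 rfl).trans ((hF₂.2 1 rfl).trans (hF₁.2 1 rfl)))
    have hsple : s'.reg 8 ≤ W := by
      have h1 := hI.count
      have h2 := hI.sum_used_le
      simp only [State.search] at h1 h2
      omega
    refine ⟨by simp only [Expr.Fits]; omega, by simp only [Expr.Fits]; omega, fun hlt => ?_⟩
    simp only [Expr.eval] at hlt
    refine Runs.of_wp_le (by decide) (wp_searchStep (v := v) hW le_rfl ?_ ?_ hch hlt ?_ ?_ ?_)
    · rw [a0, a1]; exact hab'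
    · rw [a0, a1]; exact hI
    · intro u e l s'' hu hl hused hs'' h4 hF''
      refine ⟨_, ?_, Function.update adj u (adj u).tail, ?_, ?_, ?_, rfl⟩
      · have := sum_length_tail hu hl
        have h8' : s''.reg 8 = s'.reg 8 := congrArg Search.sp hs''
        omega
      · rw [hs'']; exact hI.drop hl hused
      · intro hev
        obtain ⟨c, hc⟩ := hE hev
        -- `drop` changes only `adj`, which `Search.Euler` does not mention.
        exact ⟨c, by
          rw [hs'']
          exact ⟨hc.st_zero, hc.st_adj, hc.out_zero, hc.out_adj, hc.final, hc.parity, hc.link,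
            hc.cover⟩⟩
      · rw [h4, hF''.2 5 rfl, hF''.2 7 rfl]
        exact Lists.chain_tail hch hu hl
    · intro u e l s'' hu hl hused htop hs'' h4 hF''
      rw [a0, a1] at hs''
      refine ⟨_, ?_, Function.update adj u (adj u).tail, ?_, ?_, ?_, rfl⟩
      · have := sum_length_tail hu hl
        have h8' : s''.reg 8 = s'.reg 8 + 1 := congrArg Search.sp hs''
        omega
      · rw [hs'']; exact hI.push hab' hlt htop hl hused
      · intro hev
        obtain ⟨c, hc⟩ := hE hev
        exact ⟨c, by
          rw [hs'']
          exact hc.push hI (fun e he => (hab e he).2.2) hlt htop hl hused⟩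
      · rw [h4, hF''.2 5 rfl, hF''.2 7 rfl]
        exact Lists.chain_tail hch hu hl
    · intro u s'' hu hl htop hs'' h4 hF''
      refine ⟨_, ?_, adj, ?_, ?_, ?_, rfl⟩
      · have h8' : s''.reg 8 = s'.reg 8 - 1 := congrArg Search.sp hs''
        omega
      · rw [hs'']; exact hI.pop hlt htop hl
      · intro hev
        obtain ⟨c, hc⟩ := hE hev
        exact ⟨_, by
          rw [hs'']
          exact hc.pop hI hlt htop hl⟩
      · rw [h4, hF''.2 5 rfl, hF''.2 7 rfl]
        exact hch
  · simp [Expr.cost]; omega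
  · rintro s' hF' ⟨⟨m, adj, hI, hE, -, -⟩, hlt⟩
    simp only [Expr.eval] at hlt
    have hsp : (s'.search adj).sp = 0 := by simp only [State.search]; omega
    refine ⟨hI.tree, (hI.par_ne_zero hab' hconn hsp).1, fun hev => ?_⟩
    obtain ⟨c, hc⟩ := hE hev
    exact hI.isTour hc hab' hconn hsp

/-! ## Making all degrees even -/

/-- The degree of `x` in the graph formed by the first `M` edges. -/
def edgeDegree (a b : ℕ → ℕ) (M x : ℕ) : ℕ := unusedDegree a b M (fun _ => 0) x

theorem edgeDegree_zero (a b : ℕ → ℕ) (x : ℕ) : edgeDegree a b 0 x = 0 := rfl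

theorem edgeDegree_succ (a b : ℕ → ℕ) (M x : ℕ) : edgeDegree a b (M + 1) x =
    edgeDegree a b M x + ((if a M = x then 1 else 0) + if b M = x then 1 else 0) := by
  simp [edgeDegree, unusedDegree, Finset.sum_range_succ]

theorem edgeDegree_congr {a b a' b' : ℕ → ℕ} {M : ℕ} (h : ∀ e < M, a' e = a e ∧ b' e = b e) (x : ℕ) :
    edgeDegree a' b' M x = edgeDegree a b M x := by
  unfold edgeDegree unusedDegree
  refine Finset.sum_congr rfl fun e he => ?_
  rw [(h e (Finset.mem_range.1 he)).1, (h e (Finset.mem_range.1 he)).2]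

theorem edgeDegree_eq_zero {a b : ℕ → ℕ} {n M x : ℕ} (hab : ∀ e < M, a e < n ∧ b e < n)
    (hx : n ≤ x) : edgeDegree a b M x = 0 := by
  unfold edgeDegree unusedDegree
  refine Finset.sum_eq_zero fun e he => ?_
  have := hab e (Finset.mem_range.1 he)
  rw [if_pos rfl, if_neg (by omega), if_neg (by omega), add_zero]

theorem sum_edgeDegree {a b : ℕ → ℕ} {n M : ℕ} (hab : ∀ e < M, a e < n ∧ b e < n) :
    ∑ x ∈ Finset.range n, edgeDegree a b M x = 2 * M := by
  induction M with
  | zero => simp [edgeDegree_zero]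
  | succ M ih =>
    simp only [edgeDegree_succ, Finset.sum_add_distrib]
    rw [ih fun e he => hab e (by omega)]
    have := hab M (by omega)
    simp [this.1, this.2]
    ring

/-- By the handshake lemma the degree sum is even, so a single vertex cannot be the only one of odd
degree. -/
theorem isEven_of_forall_ne {a b : ℕ → ℕ} {n M v : ℕ} (hab : ∀ e < M, a e < n ∧ b e < n)
    (hv : v < n) (h : ∀ x < n, x ≠ v → edgeDegree a b M x % 2 = 0) : IsEven a b M := by
  have h1 := sum_edgeDegree hab
  rw [← Finset.add_sum_erase _ _ (Finset.mem_range.2 hv)] at h1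
  have h2 : 2 ∣ ∑ x ∈ (Finset.range n).erase v, edgeDegree a b M x :=
    Finset.dvd_sum fun x hx => Nat.dvd_of_mod_eq_zero
      (h x (Finset.mem_range.1 (Finset.mem_of_mem_erase hx)) (Finset.ne_of_mem_erase hx))
  intro x
  change edgeDegree a b M x % 2 = 0
  by_cases hx : x < n
  · by_cases hxv : x = v
    · subst hxv; omega
    · exact h x hx hxv
  · rw [edgeDegree_eq_zero hab (by omega)]

/-- Flip the parity of the vertex given by `x`. -/
def toggle (x : Expr) : Prog := .store 14 x (.sub (.lit 1) (.get 14 x))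

/-- Compute the parities of the degrees. -/
def computeParities : Prog :=
  .assign 4 (.lit 0) ;;
  .whileLt (.reg 4) (.reg 1)
    (toggle (.get 0 (.reg 4)) ;; toggle (.get 1 (.reg 4)) ;; .assign 4 (.add (.reg 4) (.lit 1)))

/-- Process the vertices of the tree from the last to the first, doubling the edge to the parent of
each vertex of odd degree. -/
def fixParities : Prog :=
  .whileLt (.lit 1) (.reg 10)
    (.assign 10 (.sub (.reg 10) (.lit 1)) ;;
      .assign 5 (.get 13 (.reg 10)) ;;
      .ifLt (.lit 0) (.get 14 (.reg 5))
        (.assign 11 (.sub (.get 11 (.reg 5)) (.lit 1)) ;;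
          .store 0 (.reg 1) (.reg 5) ;; .store 1 (.reg 1) (.reg 11) ;;
          .assign 1 (.add (.reg 1) (.lit 1)) ;;
          toggle (.reg 5) ;; toggle (.reg 11))
        .skip)

theorem runs_computeParities {W n M : ℕ} {s : State} (h1 : s.reg 1 = M)
    (hab : ∀ e < M, s.arr 0 e < n ∧ s.arr 1 e < n ∧ s.arr 0 e ≠ s.arr 1 e)
    (h14 : ∀ x, s.arr 14 x = 0) (hW : n + M + 1 ≤ W) :
    Runs W computeParities s (2 + (M + 1) * 40)
      fun s' => ∀ x, s'.arr 14 x = edgeDegree (s.arr 0) (s.arr 1) M x % 2 := by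
  refine Runs.seq (Runs.of_wp_le (T := 2) (Q := fun s' => s'.reg 4 = 0) (by decide) ?_)
    fun s₁ hF h4 => ?_
  · simp [Prog.wp, Expr.Fits, Expr.eval, State.setReg_reg]
  refine (Runs.while (T := 30) (m := M) (fun m s' => s'.reg 4 + m = M ∧
    ∀ x, s'.arr 14 x = edgeDegree (s.arr 0) (s.arr 1) (s'.reg 4) x % 2) ⟨by omega, ?_⟩ ?_).mono ?_ ?_
  · intro x; rw [hF.2 14 rfl, h4, edgeDegree_zero, h14]
  · rintro m s' hF' ⟨hm, hp⟩
    have h1' : s'.reg 1 = M := (hF'.1 1 rfl).trans ((hF.1 1 rfl).trans h1)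
    have a0 : s'.arr 0 = s.arr 0 := (hF'.2 0 rfl).trans (hF.2 0 rfl)
    have a1 : s'.arr 1 = s.arr 1 := (hF'.2 1 rfl).trans (hF.2 1 rfl)
    refine ⟨by simp only [Expr.Fits]; omega, by simp only [Expr.Fits]; omega, fun hlt => ?_⟩
    simp only [Expr.eval, h1'] at hlt
    obtain ⟨hx0, hx1, hne⟩ := hab _ hlt
    refine Runs.of_wp_le (by decide) ?_
    have hq0 := hp (s.arr 0 (s'.reg 4))
    have hq1 := hp (s.arr 1 (s'.reg 4))
    simp only [toggle, Prog.wp, Expr.Fits, Expr.eval, State.setReg_reg, State.setReg_arr,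
      State.setArr_reg, State.setArr_arr, reduceIte, a0, a1,
      Function.update_of_ne hne.symm, OfNat.one_ne_ofNat]
    refine ⟨⟨by omega, by omega⟩, ⟨by omega, ⟨by omega, by omega⟩, by omega⟩, ⟨by omega, by omega⟩,
      ⟨by omega, ⟨by omega, by omega⟩, by omega⟩, by omega, m - 1, by omega, by omega, fun x => ?_⟩
    rw [edgeDegree_succ]
    have := hp x
    simp only [Function.update_apply]
    grind
  · simp [Expr.cost]
  · rintro s' hF' ⟨⟨m, hm, hp⟩, hlt⟩
    have h1' : s'.reg 1 = M := (hF'.1 1 rfl).trans ((hF.1 1 rfl).trans h1)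
    simp only [Expr.eval] at hlt
    have : s'.reg 4 = M := by omega
    rwa [this] at hp

/-- `(a', b')` with `M'` edges arises from `(a, b)` with `M` edges by doubling tree edges from
distinct vertices that have odd degree or a child in the tree. -/
structure Augments (a b : ℕ → ℕ) (M : ℕ) (par ord : ℕ → ℕ) (cnt : ℕ) (a' b' : ℕ → ℕ) (M' : ℕ) :
    Prop where
  le : M ≤ M'
  old : ∀ e < M, a' e = a e ∧ b' e = b e
  new : ∀ e, M ≤ e → e < M' → ∃ i, 0 < i ∧ i < cnt ∧ a' e = ord i ∧ b' e + 1 = par (ord i) ∧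
    (edgeDegree a b M (ord i) % 2 = 1 ∨ ∃ j < cnt, 0 < j ∧ par (ord j) = ord i + 1)
  inj : ∀ e f, M ≤ e → e < M' → M ≤ f → f < M' → a' e = a' f → e = f

open Function in
theorem Augments.snoc {a b : ℕ → ℕ} {M : ℕ} {par ord : ℕ → ℕ} {cnt : ℕ} {a' b' : ℕ → ℕ} {M' : ℕ}
    (h : Augments a b M par ord cnt a' b' M') {i w : ℕ} (hi : 0 < i) (hi' : i < cnt)
    (hw : par (ord i) = w + 1)
    (hodd : edgeDegree a b M (ord i) % 2 = 1 ∨ ∃ j < cnt, 0 < j ∧ par (ord j) = ord i + 1)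
    (hne : ∀ e, M ≤ e → e < M' → a' e ≠ ord i) :
    Augments a b M par ord cnt (update a' M' (ord i)) (update b' M' w) (M' + 1) := by
  have hle := h.le
  refine ⟨by omega, fun e he => ?_, fun e he he' => ?_, fun e f he he' hf hf' => ?_⟩
  · rw [update_of_ne (by omega), update_of_ne (by omega)]; exact h.old e he
  · by_cases heM : e = M'
    · subst heM
      exact ⟨i, hi, hi', by simp, by simp [hw], hodd⟩
    · rw [update_of_ne heM, update_of_ne heM]; exact h.new e he (by omega)
  · have := h.inj e f he
    have := hne e he
    have := hne f hf
    simp only [update_apply]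
    grind

/-- The invariant of `fixParities` when the vertices `ord i`, `q ≤ i`, have been processed. -/
structure FixInv (a b : ℕ → ℕ) (M : ℕ) (par ord : ℕ → ℕ) (cnt : ℕ) (n q : ℕ) (s : State) :
    Prop where
  q_pos : 0 < q
  q_le : q ≤ cnt
  aug : Augments a b M par ord cnt (s.arr 0) (s.arr 1) (s.reg 1)
  size : s.reg 1 + q ≤ M + cnt
  parity : ∀ x < n, s.arr 14 x = edgeDegree (s.arr 0) (s.arr 1) (s.reg 1) x % 2
  done : ∀ i, q ≤ i → i < cnt → s.arr 14 (ord i) = 0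
  new : ∀ e, M ≤ e → e < s.reg 1 → ∃ i, q ≤ i ∧ i < cnt ∧ s.arr 0 e = ord i
  -- Only the processing of a child can alter the parity of a vertex that is still to be processed.
  leaf : ∀ i < q, (¬ ∃ j < cnt, 0 < j ∧ par (ord j) = ord i + 1) →
    s.arr 14 (ord i) = edgeDegree a b M (ord i) % 2

/-- Parents precede their children in `ord`. In reverse order a vertex is made even after all its
children have been dealt with, and later steps change only vertices of smaller index. The root,
never processed itself, is handled by `isEven_of_forall_ne`. -/
theorem runs_fixParities {W n M v cnt : ℕ} {par dep ord : ℕ → ℕ} {a b : ℕ → ℕ} {s : State}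
    (h1 : s.reg 1 = M) (hv : v < n) (ha : s.arr 0 = a) (hb : s.arr 1 = b)
    (hab : ∀ e < M, a e < n ∧ b e < n)
    (hT : IsTree a b n M v par dep ord cnt) (h11 : s.arr 11 = par) (h13 : s.arr 13 = ord)
    (h10 : s.reg 10 = cnt) (hall : ∀ x < n, par x ≠ 0)
    (h14 : ∀ x, s.arr 14 x = edgeDegree a b M x % 2) (hW : 2 * n + M + 2 ≤ W) :
    Runs W fixParities s ((n + 1) * 64) fun s' =>
      Augments a b M par ord cnt (s'.arr 0) (s'.arr 1) (s'.reg 1) ∧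
      IsEven (s'.arr 0) (s'.arr 1) (s'.reg 1) ∧ s'.reg 1 ≤ M + n := by
  have hcn := hT.cnt_le
  have hc0 := hT.cnt_pos
  refine (Runs.while (T := 50) (m := cnt) (fun m s' => m = s'.reg 10 ∧
    FixInv a b M par ord cnt n (s'.reg 10) s') ⟨h10.symm, ?_⟩ ?_).mono ?_ ?_
  · subst h10 ha hb
    refine ⟨hc0, le_rfl, ⟨by omega, fun _ _ => ⟨rfl, rfl⟩, fun e _ _ => by omega,
      fun e f _ _ => by omega⟩, by omega, fun x _ => by rw [h14, h1], fun i _ _ => by omega,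
      fun e _ _ => by omega, fun i _ _ => h14 _⟩
  · rintro m s' hF ⟨rfl, hI⟩
    obtain ⟨q, hq⟩ : ∃ q, s'.reg 10 = q := ⟨_, rfl⟩
    rw [hq] at hI ⊢
    have hq1 := hI.q_le
    have hq2 := hI.q_pos
    have hsz := hI.size
    have hle := hI.aug.le
    have a11 : s'.arr 11 = par := (hF.2 11 rfl).trans h11
    have a13 : s'.arr 13 = ord := (hF.2 13 rfl).trans h13
    refine ⟨by simp only [Expr.Fits]; omega, by simp only [Expr.Fits]; omega, fun hlt => ?_⟩
    simp only [Expr.eval, hq] at hlt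
    obtain ⟨j, hj, hpar, -, e₀, he₀, hjo⟩ := hT.parent (q - 1) (by omega) (by omega)
    have hun := (hT.ord_lt (q - 1) (by omega)).1
    have hwn := (hT.ord_lt j (by omega)).1
    have huw : ord (q - 1) ≠ ord j := fun he => by
      have := hT.ord_inj (q - 1) (by omega) j (by omega) he
      omega
    have hpu := hI.parity _ hun
    have hpw := hI.parity _ hwn
    refine Runs.of_wp_le (by decide) ?_
    simp only [toggle, Prog.wp, Expr.Fits, Expr.eval, State.setReg_reg, State.setReg_arr,
      State.setArr_reg, State.setArr_arr, Nat.reduceEqDiff, reduceIte, a11, a13, hq, hpar,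
      Nat.add_sub_cancel, OfNat.ofNat_ne_zero, OfNat.ofNat_ne_one, OfNat.one_ne_ofNat,
      one_ne_zero, Function.update_of_ne huw.symm]
    refine ⟨by omega, by omega, by omega, by omega, fun hp => ?_, fun hp => ?_⟩
    · refine ⟨by omega, by omega, by omega, by omega, by omega, by omega, by omega, by omega,
        by omega, by omega, q - 1, by omega, rfl, ?_⟩
      have hfresh : ∀ e, M ≤ e → e < s'.reg 1 → s'.arr 0 e ≠ ord (q - 1) := by
        intro e he he' heq
        obtain ⟨i, hi, hi', hai⟩ := hI.new e he he'
        have := hT.ord_inj i hi' (q - 1) (by omega) (hai.symm.trans heq)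
        omega
      -- A vertex without children that is odd now was odd in the input; this is what makes the
      -- added edges countable.
      have hodd : edgeDegree a b M (ord (q - 1)) % 2 = 1 ∨
          ∃ j < cnt, 0 < j ∧ par (ord j) = ord (q - 1) + 1 := by
        by_contra hcon
        rw [not_or] at hcon
        have := hI.leaf (q - 1) (by omega) hcon.2
        omega
      have hne : ∀ i < cnt, i ≠ q - 1 → ord i ≠ ord (q - 1) := fun i hi hi' he =>
        hi' (hT.ord_inj i hi (q - 1) (by omega) he)
      have hnj : ∀ i < cnt, i ≠ j → ord i ≠ ord j := fun i hi hi' he =>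
        hi' (hT.ord_inj i hi j (by omega) he)
      have haug := hI.aug.snoc (i := q - 1) (by omega) (by omega) hpar hodd hfresh
      constructor <;> try simp only [State.setReg_reg, State.setReg_arr,
        State.setArr_reg, State.setArr_arr, reduceIte,
        OfNat.ofNat_ne_zero, OfNat.ofNat_ne_one, OfNat.one_ne_ofNat,
        zero_ne_one, one_ne_zero, OfNat.zero_ne_ofNat]
      · omega
      · omega
      · exact haug
      · omega
      · intro x hx
        rw [edgeDegree_succ, edgeDegree_congr (a := s'.arr 0) (b := s'.arr 1), Function.update_self,
          Function.update_self]
        · have := hI.parity x hx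
          simp only [Function.update_apply]
          grind
        · intro e he
          rw [Function.update_of_ne (by omega), Function.update_of_ne (by omega)]
          exact ⟨rfl, rfl⟩
      · intro i hi hi'
        -- The parent has an index `j < q - 1`, so its toggle does not affect a processed vertex.
        rw [Function.update_of_ne (hnj i hi' (by omega))]
        by_cases hiq : i = q - 1
        · subst hiq; rw [Function.update_self]; omega
        · rw [Function.update_of_ne (hne i hi' hiq)]
          exact hI.done i (by omega) hi'
      · intro e he he'
        by_cases heM : e = s'.reg 1
        · exact ⟨q - 1, le_rfl, by omega, by simp [heM]⟩
        · obtain ⟨i, hi, hi', hai⟩ := hI.new e he (by omega)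
          exact ⟨i, by omega, hi', by rw [Function.update_of_ne heM, hai]⟩
      · intro i hi
        have hq3 : q - 1 < cnt := by omega
        have hq4 : 0 < q - 1 := by omega
        have hic : i < cnt := by omega
        have hiq : i < q := by omega
        intro hleaf
        have hij : i ≠ j := by
          rintro rfl
          exact hleaf ⟨q - 1, hq3, hq4, hpar⟩
        rw [Function.update_of_ne (hnj i hic hij), Function.update_of_ne (hne i hic hi.ne)]
        exact hI.leaf i hiq hleaf
    · refine ⟨q - 1, by omega, rfl, ?_⟩
      constructor <;> try simp only [State.setReg_reg, State.setReg_arr, reduceIte,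
        OfNat.one_ne_ofNat]
      · omega
      · omega
      · exact hI.aug
      · omega
      · exact hI.parity
      · intro i hi hi'
        by_cases hiq : i = q - 1
        · subst hiq; omega
        · exact hI.done i (by omega) hi'
      · intro e he he'
        obtain ⟨i, hi, hi', hai⟩ := hI.new e he he'
        exact ⟨i, by omega, hi', hai⟩
      · intro i hi
        exact hI.leaf i (by omega)
  · simp only [Expr.cost]
    have := Nat.mul_le_mul_right 64 (Nat.succ_le_succ hcn)
    simp only [Nat.succ_eq_add_one] at this
    omega
  · rintro s' hF ⟨⟨m, -, hI⟩, hlt⟩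
    simp only [Expr.eval] at hlt
    have hq2 := hI.q_pos
    have hsz := hI.size
    refine ⟨hI.aug, ?_, by omega⟩
    refine isEven_of_forall_ne (n := n) (v := v) ?_ hv fun x hx hxv => ?_
    · intro e he
      by_cases heM : e < M
      · rw [(hI.aug.old e heM).1, (hI.aug.old e heM).2]; exact hab e heM
      · obtain ⟨i, hi, hi', h5, h6, -⟩ := hI.aug.new e (by omega) he
        have h7 := hT.ord_lt i hi'
        have h8 := hT.par_le h7.1
        omega
    · obtain ⟨i, hi, rfl⟩ := hT.ord_surj x hx (hall x hx)
      have : i ≠ 0 := by rintro rfl; exact hxv hT.ord_zero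
      rw [← hI.parity _ hx]
      exact hI.done i (by omega) hi

/-! ## Writing the robot cycles -/

/-- `par x - 1` is the parent and `dep x` the depth of `x` in a spanning tree with root `v`. -/
structure IsRooted (a b : ℕ → ℕ) (n M v : ℕ) (par dep : ℕ → ℕ) : Prop where
  eq_root : ∀ x < n, dep x = 0 → x = v
  parent : ∀ x < n, 0 < dep x → par x - 1 < n ∧ dep (par x - 1) + 1 = dep x ∧
    ∃ e < M, Joins a b e x (par x - 1)
  par_le : ∀ x < n, par x ≤ n
  dep_lt : ∀ x < n, dep x < n

theorem IsTree.isRooted {a b : ℕ → ℕ} {n M v cnt : ℕ} {par dep ord : ℕ → ℕ}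
    (h : IsTree a b n M v par dep ord cnt) (hall : ∀ x < n, par x ≠ 0) :
    IsRooted a b n M v par dep := by
  refine ⟨fun x hx h0 => ?_, fun x hx hpos => ?_, fun x hx => h.par_le hx,
    fun x hx => h.dep_lt hx (hall x hx)⟩
  · obtain ⟨i, hi, rfl⟩ := h.ord_surj x hx (hall x hx)
    rcases Nat.eq_zero_or_pos i with rfl | hi0
    · exact h.ord_zero
    · obtain ⟨j, -, -, hd, -⟩ := h.parent i hi hi0
      omega
  · obtain ⟨i, hi, rfl⟩ := h.ord_surj x hx (hall x hx)
    rcases Nat.eq_zero_or_pos i with rfl | hi0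
    · rw [h.ord_zero, h.dep_root] at hpos; omega
    · obtain ⟨j, hj, hp, hd, he⟩ := h.parent i hi hi0
      rw [hp, Nat.add_sub_cancel]
      exact ⟨(h.ord_lt j (hj.trans hi)).1, hd.symm, he⟩

/-- The `j`-th ancestor of `x`. -/
def ancestor (par : ℕ → ℕ) (x j : ℕ) : ℕ := (fun y => par y - 1)^[j] x

theorem ancestor_zero (par : ℕ → ℕ) (x : ℕ) : ancestor par x 0 = x := rfl

theorem ancestor_succ (par : ℕ → ℕ) (x j : ℕ) :
    ancestor par x (j + 1) = par (ancestor par x j) - 1 := Function.iterate_succ_apply' _ _ _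

section Ancestor

variable {a b : ℕ → ℕ} {n M v : ℕ} {par dep : ℕ → ℕ} {x j : ℕ}

theorem IsRooted.ancestor_lt (h : IsRooted a b n M v par dep) (hx : x < n) (hj : j ≤ dep x) :
    ancestor par x j < n ∧ dep (ancestor par x j) + j = dep x := by
  induction j with
  | zero => exact ⟨hx, rfl⟩
  | succ j ih =>
    obtain ⟨h1, h2⟩ := ih (by omega)
    obtain ⟨h3, h4, -⟩ := h.parent _ h1 (by omega)
    rw [ancestor_succ]
    exact ⟨h3, by omega⟩

theorem IsRooted.ancestor_dep (h : IsRooted a b n M v par dep) (hx : x < n) :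
    ancestor par x (dep x) = v := by
  obtain ⟨h1, h2⟩ := h.ancestor_lt hx le_rfl
  exact h.eq_root _ h1 (by omega)

theorem IsRooted.ancestor_adj (h : IsRooted a b n M v par dep) (hx : x < n) (hj : j < dep x) :
    ∃ e < M, Joins a b e (ancestor par x j) (ancestor par x (j + 1)) := by
  obtain ⟨h1, h2⟩ := h.ancestor_lt hx hj.le
  rw [ancestor_succ]
  exact (h.parent _ h1 (by omega)).2.2

end Ancestor

/-- Write the tree path from the root to the vertex in register `5` to the output, starting at the
address in register `17`; the root itself is left out. -/
def writeDown : Prog :=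
  .whileLt (.lit 0) (.get 12 (.reg 5))
    (.store 3 (.add (.reg 17) (.get 12 (.reg 5))) (.reg 5) ;;
      .assign 5 (.sub (.get 11 (.reg 5)) (.lit 1)))

/-- Write the segment of the tour between the indices in registers `15` and `18` to the output,
behind the address in register `16`. -/
def writeSegment : Prog :=
  .whileLt (.reg 15) (.reg 18)
    (.assign 15 (.add (.reg 15) (.lit 1)) ;; .assign 16 (.add (.reg 16) (.lit 1)) ;;
      .store 3 (.reg 16) (.get 10 (.reg 15)))

/-- Write the tree path from the vertex in register `5` to the root to the output, behind the
address in register `16`. -/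
def writeUp : Prog :=
  .whileLt (.lit 0) (.get 12 (.reg 5))
    (.assign 5 (.sub (.get 11 (.reg 5)) (.lit 1)) ;; .assign 16 (.add (.reg 16) (.lit 1)) ;;
      .store 3 (.reg 16) (.reg 5))

/-! ### Tree paths and tour segments written to the output -/

section Write

variable {a b : ℕ → ℕ} {n M v W : ℕ} {s : State} {x p : ℕ}

/-- The tree can only be climbed, but the path is needed from the root downwards; each vertex is
therefore stored at the offset given by its depth. The address `p` of the root is filled in
afterwards. -/
theorem runs_writeDown (hR : IsRooted a b n M v (s.arr 11) (s.arr 12)) (h5 : s.reg 5 = x)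
    (hx : x < n) (h17 : s.reg 17 = p) (hW : p + n + 1 ≤ W) :
    Runs W writeDown s ((n + 1) * 16) fun s' => s'.reg 5 = v ∧
      (∀ j, 0 < j → j ≤ s.arr 12 x →
        s'.arr 3 (p + j) = ancestor (s.arr 11) x (s.arr 12 x - j)) ∧
      ∀ q, q ≤ p → s'.arr 3 q = s.arr 3 q := by
  refine (Runs.while (T := 12) (m := s.arr 12 x) (fun m s' => m ≤ s.arr 12 x ∧
    s'.reg 5 = ancestor (s.arr 11) x (s.arr 12 x - m) ∧
    (∀ j, m < j → j ≤ s.arr 12 x →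
      s'.arr 3 (p + j) = ancestor (s.arr 11) x (s.arr 12 x - j)) ∧
    ∀ q, q ≤ p → s'.arr 3 q = s.arr 3 q) ⟨le_rfl, ?_, fun j _ _ => by omega, fun _ _ => rfl⟩ ?_).mono
    ?_ ?_
  · rw [Nat.sub_self, h5, ancestor_zero]
  · rintro m s' hF ⟨hm, hx', hpath, hold⟩
    have h17' : s'.reg 17 = p := (hF.1 17 rfl).trans h17
    have a11 : s'.arr 11 = s.arr 11 := hF.2 11 rfl
    have a12 : s'.arr 12 = s.arr 12 := hF.2 12 rfl
    obtain ⟨h1, h2⟩ := hR.ancestor_lt (j := s.arr 12 x - m) hx (by omega)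
    rw [← hx'] at h1 h2
    have h3 := hR.dep_lt _ h1
    have h4 := hR.par_le _ h1
    simp only [Expr.Fits, Expr.eval, a12]
    refine ⟨by omega, ⟨by omega, by omega⟩, fun hlt => Runs.of_wp_le (by decide) ?_⟩
    simp only [Prog.wp, Expr.Fits, Expr.eval, State.setReg_reg, State.setReg_arr,
      State.setArr_reg, State.setArr_arr, Nat.reduceEqDiff, reduceIte, a11, a12, h17']
    refine ⟨by omega, by omega, by omega, m - 1, by omega, by omega, ?_, fun j hj hj' => ?_,
      fun q hq => ?_⟩
    · rw [hx', ← ancestor_succ]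
      congr 1; omega
    · by_cases hjm : j = m
      · subst hjm
        rw [Function.update_apply, if_pos (by omega), hx']
      · rw [Function.update_apply, if_neg (by omega)]
        exact hpath j (by omega) hj'
    · rw [Function.update_apply, if_neg (by omega)]
      exact hold q hq
  · have := hR.dep_lt x hx
    simp only [Expr.cost]
    omega
  · rintro s' hF ⟨⟨m, hm, hx', hpath, hold⟩, hlt⟩
    have a12 : s'.arr 12 = s.arr 12 := hF.2 12 rfl
    obtain ⟨h1, h2⟩ := hR.ancestor_lt (j := s.arr 12 x - m) hx (by omega)
    simp only [Expr.eval, a12, hx'] at hlt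
    have : m = 0 := by omega
    subst this
    exact ⟨by rw [hx', Nat.sub_zero, hR.ancestor_dep hx], hpath, hold⟩

theorem runs_writeUp (hR : IsRooted a b n M v (s.arr 11) (s.arr 12)) (h5 : s.reg 5 = x)
    (hx : x < n) (h16 : s.reg 16 = p) (hW : p + n + 1 ≤ W) :
    Runs W writeUp s ((n + 1) * 18) fun s' => s'.reg 16 = p + s.arr 12 x ∧
      (∀ j, 0 < j → j ≤ s.arr 12 x → s'.arr 3 (p + j) = ancestor (s.arr 11) x j) ∧
      ∀ q, q ≤ p → s'.arr 3 q = s.arr 3 q := by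
  refine (Runs.while (T := 14) (m := s.arr 12 x) (fun m s' => ∃ i, i + m = s.arr 12 x ∧
    s'.reg 5 = ancestor (s.arr 11) x i ∧ s'.reg 16 = p + i ∧
    (∀ j, 0 < j → j ≤ i → s'.arr 3 (p + j) = ancestor (s.arr 11) x j) ∧
    ∀ q, q ≤ p → s'.arr 3 q = s.arr 3 q)
    ⟨0, by omega, by rw [h5, ancestor_zero], by omega, fun j _ _ => by omega, fun _ _ => rfl⟩
    ?_).mono ?_ ?_
  · rintro m s' hF ⟨i, hm, hx', h16', hpath, hold⟩
    have a11 : s'.arr 11 = s.arr 11 := hF.2 11 rfl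
    have a12 : s'.arr 12 = s.arr 12 := hF.2 12 rfl
    obtain ⟨h1, h2⟩ := hR.ancestor_lt (j := i) hx (by omega)
    rw [← hx'] at h1 h2
    have h3 := hR.dep_lt _ h1
    have h4 := hR.par_le _ h1
    have h6 := hR.dep_lt _ hx
    simp only [Expr.Fits, Expr.eval, a12]
    refine ⟨by omega, ⟨by omega, by omega⟩, fun hlt => Runs.of_wp_le (by decide) ?_⟩
    simp only [Prog.wp, Expr.Fits, Expr.eval, State.setReg_reg, State.setReg_arr,
      State.setArr_reg, State.setArr_arr, Nat.reduceEqDiff, reduceIte, a11]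
    refine ⟨by omega, by omega, by omega, by omega, m - 1, by omega, i + 1, by omega, ?_, by omega,
      fun j hj hj' => ?_, fun q hq => ?_⟩
    · rw [ancestor_succ, hx']
    · by_cases hji : j = i + 1
      · subst hji
        rw [Function.update_apply, if_pos (by omega), ancestor_succ, hx']
      · rw [Function.update_apply, if_neg (by omega)]
        exact hpath j hj (by omega)
    · rw [Function.update_apply, if_neg (by omega)]
      exact hold q hq
  · have := hR.dep_lt x hx
    simp only [Expr.cost]
    omega
  · rintro s' hF ⟨⟨m, i, hm, hx', h16', hpath, hold⟩, hlt⟩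
    have a12 : s'.arr 12 = s.arr 12 := hF.2 12 rfl
    obtain ⟨h1, h2⟩ := hR.ancestor_lt (j := i) hx (by omega)
    simp only [Expr.eval, a12, hx'] at hlt
    have : i = s.arr 12 x := by omega
    subst this
    exact ⟨h16', hpath, hold⟩

theorem runs_writeSegment {l : ℕ} (h18 : s.reg 18 = s.reg 15 + l) (h16 : s.reg 16 = p)
    (hW : p + s.reg 15 + l + 1 ≤ W) (hout : ∀ i ≤ s.reg 15 + l, s.arr 10 i ≤ W) :
    Runs W writeSegment s ((l + 1) * 16) fun s' => s'.reg 16 = p + l ∧ s'.reg 15 = s.reg 15 + l ∧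
      (∀ j, 0 < j → j ≤ l → s'.arr 3 (p + j) = s.arr 10 (s.reg 15 + j)) ∧
      ∀ q, q ≤ p → s'.arr 3 q = s.arr 3 q := by
  refine (Runs.while (T := 12) (m := l) (fun m s' => ∃ i, i + m = l ∧
    s'.reg 15 = s.reg 15 + i ∧ s'.reg 16 = p + i ∧
    (∀ j, 0 < j → j ≤ i → s'.arr 3 (p + j) = s.arr 10 (s.reg 15 + j)) ∧
    ∀ q, q ≤ p → s'.arr 3 q = s.arr 3 q)
    ⟨0, by omega, by omega, by omega, fun j _ _ => by omega, fun _ _ => rfl⟩ ?_).mono ?_ ?_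
  · rintro m s' hF ⟨i, hm, h15', h16', hpath, hold⟩
    have a10 : s'.arr 10 = s.arr 10 := hF.2 10 rfl
    have h18' : s'.reg 18 = s.reg 15 + l := (hF.1 18 rfl).trans h18
    simp only [Expr.Fits, Expr.eval]
    refine ⟨by omega, by omega, fun hlt => Runs.of_wp_le (by decide) ?_⟩
    have ho := hout (s'.reg 15 + 1) (by omega)
    simp only [Prog.wp, Expr.Fits, Expr.eval, State.setReg_reg, State.setReg_arr,
      State.setArr_reg, State.setArr_arr, Nat.reduceEqDiff, reduceIte, a10]
    refine ⟨by omega, by omega, by omega, by omega, m - 1, by omega, i + 1, by omega, by omega,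
      by omega, fun j hj hj' => ?_, fun q hq => ?_⟩
    · by_cases hji : j = i + 1
      · subst hji
        rw [Function.update_apply, if_pos (by omega), h15', add_assoc]
      · rw [Function.update_apply, if_neg (by omega)]
        exact hpath j hj (by omega)
    · rw [Function.update_apply, if_neg (by omega)]
      exact hold q hq
  · simp [Expr.cost]
  · rintro s' hF ⟨⟨m, i, hm, h15', h16', hpath, hold⟩, hlt⟩
    have h18' : s'.reg 18 = s.reg 15 + l := (hF.1 18 rfl).trans h18
    simp only [Expr.eval] at hlt
    have : i = l := by omega
    subst this
    exact ⟨h16', h15', hpath, hold⟩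

end Write

/-- Determine the segment of the tour for the next robot and the length of the path to it. -/
def startRobot : Prog :=
  .assign 17 (.reg 16) ;;
  .assign 18 (.add (.reg 15) (.reg 12)) ;;
  .ifLt (.reg 1) (.reg 18) (.assign 18 (.reg 1)) .skip ;;
  .assign 5 (.get 10 (.reg 15)) ;;
  .assign 16 (.add (.reg 16) (.get 12 (.reg 5)))

/-- Write the length of the cycle of the robot in register `14` and advance to the next one. -/
def finishRobot : Prog :=
  .store 2 (.reg 14) (.sub (.reg 16) (.reg 17)) ;;
  .assign 16 (.add (.reg 16) (.lit 1)) ;;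
  .assign 14 (.add (.reg 14) (.lit 1))

/-- Write the cycle of the robot in register `14`. -/
def writeRobot : Prog :=
  startRobot ;; writeDown ;; .store 3 (.reg 17) (.reg 5) ;; writeSegment ;;
    .assign 5 (.get 10 (.reg 18)) ;; writeUp ;; finishRobot

/-- `f` is the vertex sequence of a closed walk of length `len` from `v`, with
`len ≤ dep (out i) + (j - i) + dep (out j)`, that contains the segment of `out` from `i` to `j`. -/
structure IsRoute (a b : ℕ → ℕ) (M v : ℕ) (dep out : ℕ → ℕ) (i j : ℕ) (f : ℕ → ℕ) (len : ℕ) :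
    Prop where
  first : f 0 = v
  last : f len = v
  adj : ∀ t < len, ∃ e < M, Joins a b e (f t) (f (t + 1))
  cover : ∀ t, i ≤ t → t < j → ∃ r < len, f r = out t ∧ f (r + 1) = out (t + 1)
  len_eq : len = dep (out i) + (j - i) + dep (out j)

theorem IsRoute.congr {a b : ℕ → ℕ} {M v : ℕ} {dep out : ℕ → ℕ} {i j len : ℕ} {f g : ℕ → ℕ}
    (h : IsRoute a b M v dep out i j f len) (hfg : ∀ t ≤ len, g t = f t) :
    IsRoute a b M v dep out i j g len := by
  refine ⟨by rw [hfg 0 (by omega), h.first], by rw [hfg _ le_rfl, h.last], fun t ht => ?_,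
    fun t ht ht' => ?_, h.len_eq⟩
  · rw [hfg t (by omega), hfg (t + 1) (by omega)]; exact h.adj t ht
  · obtain ⟨r, hr, h1, h2⟩ := h.cover t ht ht'
    exact ⟨r, hr, by rw [hfg r (by omega), h1], by rw [hfg (r + 1) (by omega), h2]⟩

/-- The three parts overlap in their end points, so every step of `f` lies within one of them and no
junction has to be treated separately. -/
theorem isRoute_of_parts {a b : ℕ → ℕ} {n M v : ℕ} {par dep out f : ℕ → ℕ} {i l d₁ d₂ : ℕ}
    (hR : IsRooted a b n M v par dep) (hout : ∀ t < l, ∃ e < M, Joins a b e (out (i + t)) (out (i + t + 1)))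
    (hi : out i < n) (hj : out (i + l) < n) (hd₁ : dep (out i) = d₁) (hd₂ : dep (out (i + l)) = d₂)
    (h₁ : ∀ t ≤ d₁, f t = ancestor par (out i) (d₁ - t))
    (h₂ : ∀ t ≤ l, f (d₁ + t) = out (i + t))
    (h₃ : ∀ t ≤ d₂, f (d₁ + l + t) = ancestor par (out (i + l)) t) :
    IsRoute a b M v dep out i (i + l) f (d₁ + l + d₂) := by
  subst hd₁ hd₂
  refine ⟨?_, ?_, fun t ht => ?_, fun t ht ht' => ?_, by omega⟩
  · rw [h₁ 0 (by omega), Nat.sub_zero, hR.ancestor_dep hi]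
  · rw [h₃ _ le_rfl, hR.ancestor_dep hj]
  · by_cases hc₁ : t < dep (out i)
    · obtain ⟨e, he, hj⟩ := hR.ancestor_adj (j := dep (out i) - (t + 1)) hi (by omega)
      refine ⟨e, he, ?_⟩
      rw [h₁ t hc₁.le, h₁ (t + 1) hc₁]
      rw [show dep (out i) - (t + 1) + 1 = dep (out i) - t by omega] at hj
      exact hj.symm
    · by_cases hc₂ : t < dep (out i) + l
      · obtain ⟨r, rfl⟩ := Nat.exists_eq_add_of_le (Nat.le_of_not_lt hc₁)
        rw [h₂ r (by omega), add_assoc, h₂ (r + 1) (by omega), ← add_assoc]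
        exact hout r (by omega)
      · obtain ⟨r, rfl⟩ := Nat.exists_eq_add_of_le (Nat.le_of_not_lt hc₂)
        rw [h₃ r (by omega), add_assoc _ r, h₃ (r + 1) (by omega)]
        exact hR.ancestor_adj hj (by omega)
  · obtain ⟨r, rfl⟩ := Nat.exists_eq_add_of_le ht
    exact ⟨dep (out i) + r, by omega, h₂ r (by omega), by
      rw [add_assoc, h₂ (r + 1) (by omega), add_assoc]⟩

theorem runs_writeRobot {a b : ℕ → ℕ} {n M v W p i l : ℕ} {s : State}
    (hR : IsRooted a b n M v (s.arr 11) (s.arr 12)) (hT : IsTour a b M v (s.arr 10))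
    (hab : ∀ e < M, a e < n ∧ b e < n) (hv : v < n) (h1 : s.reg 1 = M) (h15 : s.reg 15 = i)
    (hl : i + l = min (i + s.reg 12) M) (hi : i ≤ M)
    (h16 : s.reg 16 = p) (hW : p + 2 * n + M + s.reg 12 + s.reg 14 + 2 ≤ W) :
    Runs W writeRobot s (100 * (n + s.reg 12 + 1)) fun s' => s'.reg 15 = i + l ∧
      s'.reg 14 = s.reg 14 + 1 ∧ (∀ q < p, s'.arr 3 q = s.arr 3 q) ∧
      ∃ len, s'.arr 2 = Function.update (s.arr 2) (s.reg 14) len ∧ s'.reg 16 = p + len + 1 ∧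
        IsRoute a b M v (s.arr 12) (s.arr 10) i (i + l) (fun j => s'.arr 3 (p + j)) len := by
  have hlt : ∀ t ≤ M, s.arr 10 t < n := by
    intro t ht
    rcases Nat.lt_or_ge t M with ht' | ht'
    · obtain ⟨e, he, hj⟩ := hT.adj t ht'
      have := hab e he
      unfold Joins at hj
      omega
    · rw [show t = M by omega, hT.last]; exact hv
  have hx := hlt i hi
  have hy := hlt (i + l) (by omega)
  have hdx := hR.dep_lt _ hx
  have hdy := hR.dep_lt _ hy
  refine (Runs.seq (Runs.of_wp_le (T := 30) (by decide) (Q := fun s₁ => s₁.reg 17 = p ∧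
    s₁.reg 18 = i + l ∧ s₁.reg 5 = s.arr 10 i ∧ s₁.reg 16 = p + s.arr 12 (s.arr 10 i)) ?_)
    fun s₁ hF₁ ⟨h17₁, h18₁, h5₁, h16₁⟩ =>
    Runs.seq (runs_writeDown (a := a) (b := b) (n := n) (M := M) (v := v) (W := W) ?_ h5₁ hx h17₁
      (by omega)) fun s₂ hF₂ ⟨h5₂, hd₂, hold₂⟩ =>
    -- `writeDown` ends with register `5` at the root, which is now stored at the first address of
    -- the cycle.
    Runs.seq (Runs.of_wp_le (T := 3) (by decide)
      (Q := fun s₃ => s₃.arr 3 = Function.update (s₂.arr 3) p v) ?_) fun s₃ hF₃ h3₃ =>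
    Runs.seq (runs_writeSegment (l := l) (p := p + s.arr 12 (s.arr 10 i)) (W := W) ?_ ?_ ?_ ?_)
      fun s₄ hF₄ ⟨h16₄, h15₄, hd₄, hold₄⟩ =>
    Runs.seq (Runs.of_wp_le (T := 3) (by decide)
      (Q := fun s₅ => s₅.reg 5 = s.arr 10 (i + l)) ?_) fun s₅ hF₅ h5₅ =>
    Runs.seq (runs_writeUp (a := a) (b := b) (n := n) (M := M) (v := v) (W := W) ?_ h5₅ hy
      ((hF₅.1 16 rfl).trans h16₄) (by omega)) fun s₆ hF₆ ⟨h16₆, hd₆, hold₆⟩ =>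
    Runs.of_wp_le (T := 20) (by decide) ?_).mono ?_ fun _ _ h => h
  · simp only [startRobot, Prog.wp, Expr.Fits, Expr.eval, State.setReg_reg, State.setReg_arr,
      Nat.reduceEqDiff, reduceIte, h1, h15, h16]
    refine ⟨by omega, ⟨by omega, by omega, by omega⟩, by omega, by omega, fun hc => ?_,
      fun hc => ?_⟩
    · refine ⟨by omega, ⟨by omega, by omega⟩, ⟨by omega, ⟨by omega, by omega⟩, by omega⟩, trivial,
        by omega, trivial, trivial⟩
    · refine ⟨⟨by omega, by omega⟩, ⟨by omega, ⟨by omega, by omega⟩, by omega⟩, trivial,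
        by omega, trivial, trivial⟩
  · rw [hF₁.2 11 rfl, hF₁.2 12 rfl]; exact hR
  · have h17₂ : s₂.reg 17 = p := (hF₂.1 17 rfl).trans h17₁
    simp only [Prog.wp, Expr.Fits, Expr.eval, State.setArr_arr, reduceIte, h17₂, h5₂]
    exact ⟨by omega, by omega, trivial⟩
  · rw [hF₃.1 18 rfl, hF₂.1 18 rfl, h18₁, hF₃.1 15 rfl, hF₂.1 15 rfl, hF₁.1 15 rfl, h15]
  · rw [hF₃.1 16 rfl, hF₂.1 16 rfl, h16₁]
  · rw [hF₃.1 15 rfl, hF₂.1 15 rfl, hF₁.1 15 rfl, h15]; omega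
  · rw [hF₃.1 15 rfl, hF₂.1 15 rfl, hF₁.1 15 rfl, h15, hF₃.2 10 rfl, hF₂.2 10 rfl, hF₁.2 10 rfl]
    intro t ht
    have := hlt t (by omega)
    omega
  · have h18₄ : s₄.reg 18 = i + l := by
      rw [hF₄.1 18 rfl, hF₃.1 18 rfl, hF₂.1 18 rfl, h18₁]
    have a10 : s₄.arr 10 = s.arr 10 := by
      rw [hF₄.2 10 rfl, hF₃.2 10 rfl, hF₂.2 10 rfl, hF₁.2 10 rfl]
    simp only [Prog.wp, Expr.Fits, Expr.eval, State.setReg_reg, reduceIte, h18₄, a10]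
    exact ⟨⟨by omega, by omega⟩, trivial⟩
  · rw [hF₅.2 11 rfl, hF₄.2 11 rfl, hF₃.2 11 rfl, hF₂.2 11 rfl, hF₁.2 11 rfl,
      hF₅.2 12 rfl, hF₄.2 12 rfl, hF₃.2 12 rfl, hF₂.2 12 rfl, hF₁.2 12 rfl]
    exact hR
  · have e15 : s₃.reg 15 = i := by rw [hF₃.1 15 rfl, hF₂.1 15 rfl, hF₁.1 15 rfl, h15]
    have e15' : s₆.reg 15 = i + l := by rw [hF₆.1 15 rfl, hF₅.1 15 rfl, h15₄, e15]
    have e14 : s₆.reg 14 = s.reg 14 := by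
      rw [hF₆.1 14 rfl, hF₅.1 14 rfl, hF₄.1 14 rfl, hF₃.1 14 rfl, hF₂.1 14 rfl, hF₁.1 14 rfl]
    have e17 : s₆.reg 17 = p := by
      rw [hF₆.1 17 rfl, hF₅.1 17 rfl, hF₄.1 17 rfl, hF₃.1 17 rfl, hF₂.1 17 rfl, h17₁]
    have e2 : s₆.arr 2 = s.arr 2 := by
      rw [hF₆.2 2 rfl, hF₅.2 2 rfl, hF₄.2 2 rfl, hF₃.2 2 rfl, hF₂.2 2 rfl, hF₁.2 2 rfl]
    have a12₅ : s₅.arr 12 = s.arr 12 := by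
      rw [hF₅.2 12 rfl, hF₄.2 12 rfl, hF₃.2 12 rfl, hF₂.2 12 rfl, hF₁.2 12 rfl]
    have a11₅ : s₅.arr 11 = s.arr 11 := by
      rw [hF₅.2 11 rfl, hF₄.2 11 rfl, hF₃.2 11 rfl, hF₂.2 11 rfl, hF₁.2 11 rfl]
    have a10₃ : s₃.arr 10 = s.arr 10 := by rw [hF₃.2 10 rfl, hF₂.2 10 rfl, hF₁.2 10 rfl]
    have a3₅ : s₅.arr 3 = s₄.arr 3 := hF₅.2 3 rfl
    have a3₁ : s₁.arr 3 = s.arr 3 := hF₁.2 3 rfl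
    rw [hF₁.2 12 rfl, hF₁.2 11 rfl] at hd₂
    rw [a12₅] at h16₆ hd₆
    rw [a11₅] at hd₆
    rw [a10₃, e15] at hd₄
    rw [a3₁] at hold₂
    rw [a3₅] at hold₆
    have hdx' := hR.dep_lt _ hx
    simp only [finishRobot, Prog.wp, Expr.Fits, Expr.eval, State.setReg_reg, State.setReg_arr,
      State.setArr_reg, State.setArr_arr, Nat.reduceEqDiff, reduceIte, e14, e15', e17, e2, h16₆]
    refine ⟨by omega, by omega, by omega, by omega, trivial, trivial, fun q hq => ?_,
      s.arr 12 (s.arr 10 i) + l + s.arr 12 (s.arr 10 (i + l)), ?_, by omega, ?_⟩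
    · rw [hold₆ q (by omega), hold₄ q (by omega), h3₃, Function.update_of_ne (by omega),
        hold₂ q (by omega)]
    · congr 1; omega
    · have hdown : ∀ t ≤ s.arr 12 (s.arr 10 i), s₆.arr 3 (p + t) =
          ancestor (s.arr 11) (s.arr 10 i) (s.arr 12 (s.arr 10 i) - t) := by
        intro t ht
        rw [hold₆ _ (by omega), hold₄ _ (by omega), h3₃]
        rcases Nat.eq_zero_or_pos t with rfl | hpos
        · rw [add_zero, Function.update_self, Nat.sub_zero, hR.ancestor_dep hx]
        · rw [Function.update_of_ne (by omega), hd₂ t hpos ht]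
      have hseg : ∀ t ≤ l, s₆.arr 3 (p + (s.arr 12 (s.arr 10 i) + t)) = s.arr 10 (i + t) := by
        intro t ht
        rcases Nat.eq_zero_or_pos t with rfl | hpos
        · rw [add_zero, hdown _ le_rfl, Nat.sub_self, ancestor_zero, add_zero]
        · rw [hold₆ _ (by omega), ← add_assoc, hd₄ t hpos ht]
      refine isRoute_of_parts hR (fun t ht => hT.adj (i + t) (by omega)) hx hy rfl rfl hdown hseg ?_
      intro t ht
      rcases Nat.eq_zero_or_pos t with rfl | hpos
      · rw [add_zero, hseg l le_rfl, ancestor_zero]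
      · rw [← hd₆ t hpos ht]; congr 1; omega
  · omega

/-- Divide the number of edges in register `1` by the number of robots in register `3`, rounding
up. -/
def computeBlock : Prog :=
  .assign 12 (.lit 0) ;; .assign 13 (.lit 0) ;;
  .whileLt (.reg 13) (.reg 1)
    (.assign 12 (.add (.reg 12) (.lit 1)) ;; .assign 13 (.add (.reg 13) (.reg 3)))

/-- Write the cycles of all robots. -/
def writeRobots : Prog :=
  (.assign 14 (.lit 0) ;; .assign 15 (.lit 0) ;; .assign 16 (.lit 0)) ;;
  .whileLt (.reg 14) (.reg 3) writeRobot

/-- The whole algorithm. -/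
def exploration : Prog :=
  search ;; computeParities ;; fixParities ;; search ;; computeBlock ;; writeRobots

/-- The machine has no division, so multiples of `k` are accumulated until they reach `M`; as `k` is
positive, at most `M` rounds are needed. -/
theorem runs_computeBlock {W M k : ℕ} {s : State} (h1 : s.reg 1 = M) (h3 : s.reg 3 = k)
    (hk : 0 < k) (hW : M + k ≤ W) :
    Runs W computeBlock s (4 + (M + 1) * 12) fun s' => M ≤ k * s'.reg 12 ∧ k * s'.reg 12 < M + k := by
  refine (Runs.seq (Runs.of_wp_le (T := 2) (Q := fun s' => s'.reg 12 = 0) (by decide) ?_)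
    fun s₁ hF₁ h12 => Runs.seq (Runs.of_wp_le (T := 2) (Q := fun s' => s'.reg 13 = 0) (by decide) ?_)
    fun s₂ hF₂ h13 => Runs.while (T := 8) (m := M) (fun m s' => s'.reg 13 = k * s'.reg 12 ∧
      s'.reg 13 < M + k ∧ s'.reg 12 ≤ s'.reg 13 ∧ m = M - s'.reg 13) ?_ ?_).mono ?_ ?_
  · simp [Prog.wp, Expr.Fits, Expr.eval, State.setReg_reg]
  · simp [Prog.wp, Expr.Fits, Expr.eval, State.setReg_reg]
  · rw [h13, hF₂.1 12 rfl, h12]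
    exact ⟨by simp, by omega, by omega, by omega⟩
  · rintro m s' hF ⟨hm, hlt, hle, rfl⟩
    have h1' : s'.reg 1 = M := by rw [hF.1 1 rfl, hF₂.1 1 rfl, hF₁.1 1 rfl, h1]
    have h3' : s'.reg 3 = k := by rw [hF.1 3 rfl, hF₂.1 3 rfl, hF₁.1 3 rfl, h3]
    simp only [Expr.Fits, Expr.eval, h1']
    refine ⟨by omega, by omega, fun hc => Runs.of_wp_le (by decide) ?_⟩
    simp only [Prog.wp, Expr.Fits, Expr.eval, State.setReg_reg, Nat.reduceEqDiff, reduceIte, h3']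
    refine ⟨by omega, by omega, M - (s'.reg 13 + k), by omega, ?_, by omega, by omega, rfl⟩
    rw [hm, Nat.mul_succ]
  · simp only [Expr.cost]; omega
  · rintro s' hF ⟨⟨m, hm, hlt, -, -⟩, hc⟩
    have h1' : s'.reg 1 = M := (hF.1 1 rfl).trans h1
    simp only [Expr.eval, h1'] at hc
    omega

/-- The address at which the output of the `i`-th robot starts, for cycles of the given lengths. -/
def offset (len : ℕ → ℕ) (i : ℕ) : ℕ := ∑ j ∈ Finset.range i, (len j + 1)

theorem offset_succ (len : ℕ → ℕ) (i : ℕ) : offset len (i + 1) = offset len i + (len i + 1) :=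
  Finset.sum_range_succ _ _

theorem offset_mono (len : ℕ → ℕ) {i j : ℕ} (h : i ≤ j) : offset len i ≤ offset len j :=
  Finset.sum_le_sum_of_subset (Finset.range_subset_range.2 h)

theorem offset_update (len : ℕ → ℕ) {i j : ℕ} (x : ℕ) (h : i ≤ j) :
    offset (Function.update len j x) i = offset len i :=
  Finset.sum_congr rfl fun r hr => by
    rw [Function.update_of_ne (by have := Finset.mem_range.1 hr; omega)]

/-- The cycle of the `i`-th robot has been written. -/
def RobotDone (a b : ℕ → ℕ) (M v B : ℕ) (dep out len walk : ℕ → ℕ) (i : ℕ) : Prop :=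
  IsRoute a b M v dep out (min (i * B) M) (min ((i + 1) * B) M) (fun j => walk (offset len i + j))
    (len i)

theorem runs_writeRobots {a b : ℕ → ℕ} {n M v W k B : ℕ} {s : State}
    (hR : IsRooted a b n M v (s.arr 11) (s.arr 12)) (hT : IsTour a b M v (s.arr 10))
    (hab : ∀ e < M, a e < n ∧ b e < n) (hv : v < n) (h1 : s.reg 1 = M) (h3 : s.reg 3 = k)
    (h12 : s.reg 12 = B) (hW : k * (2 * n + B + 1) + 2 * n + M + B + k + 2 ≤ W) :
    Runs W writeRobots s (6 + (k + 1) * (100 * (n + B + 1) + 3)) fun s' =>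
      ∀ i < k, RobotDone a b M v B (s.arr 12) (s.arr 10) (s'.arr 2) (s'.arr 3) i := by
  refine (Runs.seq (Runs.of_wp_le (T := 6)
    (Q := fun s' => s'.reg 14 = 0 ∧ s'.reg 15 = 0 ∧ s'.reg 16 = 0) (by decide) ?_)
    fun s₁ hF₁ ⟨h14, h15, h16⟩ => Runs.while (T := 100 * (n + B + 1)) (m := k)
    (fun m s' => s'.reg 14 + m = k ∧ s'.reg 15 = min (s'.reg 14 * B) M ∧
      s'.reg 16 = offset (s'.arr 2) (s'.reg 14) ∧
      -- Two tree paths shorter than `n`, at most `B` tour edges, and one cell more because a walk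
      -- has one more vertex than edges.
      s'.reg 16 ≤ s'.reg 14 * (2 * n + B + 1) ∧
      ∀ i < s'.reg 14, RobotDone a b M v B (s.arr 12) (s.arr 10) (s'.arr 2) (s'.arr 3) i)
    ?_ ?_).mono ?_ ?_
  · simp [Prog.wp, Expr.Fits, Expr.eval, State.setReg_reg]
  · rw [h14, h15, h16]
    exact ⟨by omega, by simp, rfl, by omega, fun i hi => by omega⟩
  · rintro m s' hF ⟨hm, h15', h16', hle, hdone⟩
    obtain ⟨i, hi⟩ : ∃ i, s'.reg 14 = i := ⟨_, rfl⟩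
    rw [hi] at hm h15' h16' hle hdone
    have hik := Nat.mul_le_mul_right (2 * n + B + 1) (show i ≤ k by omega)
    have h3' : s'.reg 3 = k := by rw [hF.1 3 rfl, hF₁.1 3 rfl, h3]
    have h12' : s'.reg 12 = B := by rw [hF.1 12 rfl, hF₁.1 12 rfl, h12]
    have a11 : s'.arr 11 = s.arr 11 := by rw [hF.2 11 rfl, hF₁.2 11 rfl]
    have a12 : s'.arr 12 = s.arr 12 := by rw [hF.2 12 rfl, hF₁.2 12 rfl]
    have a10 : s'.arr 10 = s.arr 10 := by rw [hF.2 10 rfl, hF₁.2 10 rfl]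
    simp only [Expr.Fits, Expr.eval, hi, h3']
    refine ⟨by omega, by omega, fun hc => ?_⟩
    have hsucc : (i + 1) * B = i * B + B := Nat.succ_mul i B
    have hsucc' : (i + 1) * (2 * n + B + 1) = i * (2 * n + B + 1) + (2 * n + B + 1) :=
      Nat.succ_mul i _
    refine (runs_writeRobot (a := a) (b := b) (n := n) (M := M) (v := v)
      (l := min (s'.reg 15 + B) M - s'.reg 15) ?_ ?_ hab hv ?_ rfl ?_ ?_ h16' ?_).mono ?_ ?_
    · rw [a11, a12]; exact hR
    · rw [a10]; exact hT
    · rw [hF.1 1 rfl, hF₁.1 1 rfl, h1]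
    · rw [h12']; omega
    · omega
    · rw [h12', hi]; omega
    · rw [h12']
    · rintro s'' hF'' ⟨h15'', h14'', hold, len, h2, h16'', hroute⟩
      rw [a12, a10] at hroute
      rw [hi] at h2 h14''
      have hend : s'.reg 15 + (min (s'.reg 15 + B) M - s'.reg 15) = min ((i + 1) * B) M := by omega
      rw [hend] at hroute h15''
      have hlen := hroute.len_eq
      have hlt : ∀ t ≤ M, s.arr 10 t < n := by
        intro t ht
        rcases Nat.lt_or_ge t M with ht' | ht'
        · obtain ⟨e, he, hj⟩ := hT.adj t ht'
          have := hab e he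
          unfold Joins at hj
          omega
        · rw [show t = M by omega, hT.last]; exact hv
      have hd₁ := hR.dep_lt _ (hlt (s'.reg 15) (by omega))
      have hd₂ := hR.dep_lt _ (hlt (min ((i + 1) * B) M) (by omega))
      rw [h15'] at hd₁ hlen
      refine ⟨m - 1, by omega, by omega, by rw [h15'', h14''], ?_, ?_, ?_⟩
      · rw [h2, h14'', offset_succ, offset_update _ _ le_rfl, Function.update_self]
        omega
      · rw [h16'', h14'', ← h16', hsucc']; omega
      · intro r hr
        rw [h14''] at hr
        unfold RobotDone
        rw [h2, offset_update _ _ (by omega)]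
        rcases Nat.lt_succ_iff_lt_or_eq.1 hr with hlt | rfl
        · rw [Function.update_of_ne (by omega)]
          -- Earlier cycles lie entirely below the address at which the current robot starts to
          -- write.
          refine (hdone r hlt).congr fun t ht => hold _ ?_
          have h1 := offset_succ (s'.arr 2) r
          have h2 := offset_mono (s'.arr 2) (show r + 1 ≤ i by omega)
          omega
        · rw [Function.update_self, ← h15']
          exact hroute
  · exact le_rfl
  · rintro s' hF ⟨⟨m, hm, -, -, -, hdone⟩, hc⟩
    have h3' : s'.reg 3 = k := (hF.1 3 rfl).trans h3
    simp only [Expr.eval, h3'] at hc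
    exact fun i hi => hdone i (by omega)

/-- Every added edge is parallel to an input edge. Hence trails in the augmented graph are walks in
`G`, and a vertex cover of `G` still covers all edges. -/
theorem Augments.lt {a b : ℕ → ℕ} {n M v : ℕ} {par dep ord : ℕ → ℕ} {cnt : ℕ} {a' b' : ℕ → ℕ}
    {M' : ℕ} (h : Augments a b M par ord cnt a' b' M') (hT : IsTree a b n M v par dep ord cnt)
    (hab : ∀ e < M, a e < n ∧ b e < n ∧ a e ≠ b e) {e : ℕ} (he : e < M') :
    (a' e < n ∧ b' e < n ∧ a' e ≠ b' e) ∧ ∃ f < M, Joins a b f (a' e) (b' e) := by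
  by_cases heM : e < M
  · rw [(h.old e heM).1, (h.old e heM).2]
    exact ⟨hab e heM, e, heM, .inl ⟨rfl, rfl⟩⟩
  · obtain ⟨i, hi, hi', h1, h2, -⟩ := h.new e (by omega) he
    obtain ⟨j, hj, h3, -, hjo⟩ := hT.parent i hi' hi
    have h4 : b' e = ord j := by omega
    rw [h1, h4]
    refine ⟨⟨(hT.ord_lt i hi').1, (hT.ord_lt j (by omega)).1, fun he => ?_⟩, hjo⟩
    have := hT.ord_inj i hi' j (by omega) he
    omega

/-- The result of `exploration`, in terms of the input graph `(a, b)` with `m` edges. -/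
def IsResult (a b : ℕ → ℕ) (n m v k : ℕ) (s : State) : Prop :=
  ∃ (par₁ dep₁ ord₁ : ℕ → ℕ) (cnt₁ : ℕ) (a' b' : ℕ → ℕ) (M : ℕ) (par dep out : ℕ → ℕ) (B : ℕ),
    IsTree a b n m v par₁ dep₁ ord₁ cnt₁ ∧ Augments a b m par₁ ord₁ cnt₁ a' b' M ∧
    IsRooted a' b' n M v par dep ∧ IsTour a' b' M v out ∧ M ≤ k * B ∧ k * B < M + k ∧
    ∀ i < k, RobotDone a' b' M v B dep out (s.arr 2) (s.arr 3) i

theorem runs_exploration {W n m v k : ℕ} {s : State} (h0 : s.reg 0 = n) (h1 : s.reg 1 = m)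
    (h2 : s.reg 2 = v) (h3 : s.reg 3 = k) (h14 : ∀ x, s.arr 14 x = 0) (hv : v < n) (hk : 0 < k)
    (hab : ∀ e < m, s.arr 0 e < n ∧ s.arr 1 e < n ∧ s.arr 0 e ≠ s.arr 1 e)
    (hconn : IsConn (s.arr 0) (s.arr 1) n m v) (hW : 20000 * ((n + m) * k) ≤ W) :
    Runs W exploration s (20000 * ((n + m) * k)) (IsResult (s.arr 0) (s.arr 1) n m v k) := by
  -- Naming the product makes the remaining estimates linear: `n + m`, `k` and `k * n` are all at
  -- most `N`.
  obtain ⟨N, hN⟩ : ∃ N, (n + m) * k = N := ⟨_, rfl⟩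
  have hN1 : n + m ≤ N := hN ▸ Nat.le_mul_of_pos_right _ hk
  have hN2 : k ≤ N := hN ▸ Nat.le_mul_of_pos_left _ (by omega)
  have hN3 : k * n ≤ N := by rw [← hN, mul_comm]; exact Nat.mul_le_mul_right k (by omega)
  rw [hN] at hW ⊢
  refine Runs.mono (T := 1000 * (n + m + 1) + ((2 + (m + 1) * 40) + ((n + 1) * 64 +
    (12000 * N)))) (Runs.seq (runs_search h0 h1 h2 hv hab hconn (by omega))
    fun s₁ hF₁ ⟨hT₁, hall₁, _⟩ => Runs.seq (runs_computeParities (n := n) (M := m) ?_ ?_ ?_ ?_)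
    fun s₂ hF₂ hp₂ => Runs.seq (runs_fixParities (n := n) (M := m) (v := v) (a := s.arr 0)
      (b := s.arr 1) (par := s₁.arr 11) (dep := s₁.arr 12) (ord := s₁.arr 13) (cnt := s₁.reg 10)
      ?_ hv ?_ ?_ ?_ hT₁ ?_ ?_ ?_ hall₁ ?_ ?_) fun s₃ hF₃ ⟨haug, heven, hM⟩ => ?_) (by omega)
      fun _ _ h => h
  · rw [hF₁.1 1 rfl, h1]
  · rw [hF₁.2 0 rfl, hF₁.2 1 rfl]; exact hab
  · rw [hF₁.2 14 rfl]; exact h14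
  · omega
  · rw [hF₂.1 1 rfl, hF₁.1 1 rfl, h1]
  · rw [hF₂.2 0 rfl, hF₁.2 0 rfl]
  · rw [hF₂.2 1 rfl, hF₁.2 1 rfl]
  · exact fun e he => ⟨(hab e he).1, (hab e he).2.1⟩
  · rw [hF₂.2 11 rfl]
  · rw [hF₂.2 13 rfl]
  · rw [hF₂.1 10 rfl]
  · rwa [hF₁.2 0 rfl, hF₁.2 1 rfl] at hp₂
  · omega
  have hab₃ := fun e he => (haug.lt hT₁ hab (e := e) he).1
  have hab₃' : ∀ e < s₃.reg 1, s₃.arr 0 e < n ∧ s₃.arr 1 e < n :=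
    fun e he => ⟨(hab₃ e he).1, (hab₃ e he).2.1⟩
  -- A predicate invariant under all edges of the augmented graph is in particular invariant under
  -- the original ones.
  have hconn₃ : IsConn (s₃.arr 0) (s₃.arr 1) n (s₃.reg 1) v := by
    intro P hPv hP
    refine hconn P hPv fun e he => ?_
    rw [← (haug.old e he).1, ← (haug.old e he).2]
    exact hP e (by have := haug.le; omega)
  refine Runs.mono (T := 1000 * (n + s₃.reg 1 + 1) + (4 + (s₃.reg 1 + 1) * 12 + 5000 * N))
    (Runs.seq (runs_search (M := s₃.reg 1) (v := v) (n := n) ?_ rfl ?_ hv hab₃ hconn₃ (by omega))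
    fun s₄ hF₄ ⟨hT₄, hall₄, htour⟩ => Runs.seq (runs_computeBlock (M := s₃.reg 1) (k := k)
      ?_ ?_ hk (by omega)) fun s₅ hF₅ ⟨hB, hB'⟩ => ?_) (by omega) fun _ _ h => h
  · rw [hF₃.1 0 rfl, hF₂.1 0 rfl, hF₁.1 0 rfl, h0]
  · rw [hF₃.1 2 rfl, hF₂.1 2 rfl, hF₁.1 2 rfl, h2]
  · rw [hF₄.1 1 rfl]
  · rw [hF₄.1 3 rfl, hF₃.1 3 rfl, hF₂.1 3 rfl, hF₁.1 3 rfl, h3]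
  have hR := hT₄.isRooted hall₄
  -- Together with `k * B < M + k` and `M ≤ m + n`, this bounds both `B` and `k * B` linearly in
  -- `N`.
  have hBle : s₅.reg 12 ≤ k * s₅.reg 12 := Nat.le_mul_of_pos_left _ hk
  have e1 : k * (2 * n + s₅.reg 12 + 1) = 2 * (k * n) + k * s₅.reg 12 + k := by ring
  have e2 : (k + 1) * (100 * (n + s₅.reg 12 + 1) + 3) = 100 * (k * n) + 100 * (k * s₅.reg 12)
    + 103 * k + 100 * n + 100 * s₅.reg 12 + 103 := by ring
  refine (runs_writeRobots (a := s₃.arr 0) (b := s₃.arr 1) (n := n) (M := s₃.reg 1) (v := v) (k := k)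
    (B := s₅.reg 12) ?_ ?_ hab₃' hv ?_ ?_ rfl ?_).mono ?_ ?_
  · rw [hF₅.2 11 rfl, hF₅.2 12 rfl]; exact hR
  · rw [hF₅.2 10 rfl]; exact htour heven
  · rw [hF₅.1 1 rfl, hF₄.1 1 rfl]
  · rw [hF₅.1 3 rfl, hF₄.1 3 rfl, hF₃.1 3 rfl, hF₂.1 3 rfl, hF₁.1 3 rfl, h3]
  · rw [e1]; omega
  · rw [e2]; omega
  · intro s₆ hF₆ hdone
    rw [hF₅.2 12 rfl, hF₅.2 10 rfl] at hdone
    exact ⟨_, _, _, _, _, _, _, _, _, _, _, hT₁, haug, hR, htour heven, hB, hB', hdone⟩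

/-! ## The lower bound -/

section LowerBound

variable {V : Type*} [Fintype V] [DecidableEq V] {G : SimpleGraph V} [DecidableRel G.Adj]

/-- Every passage of a walk through `x` uses two edge ends at `x`; only the start and the end of the
walk contribute a single one. For a closed walk the two corrections agree. -/
theorem even_sum_count_edges {u w : V} (p : G.Walk u w) (x : V) :
    ((∑ e ∈ G.edgeFinset, if x ∈ e then p.edges.count e else 0) +
      (if x = u then 1 else 0) + (if x = w then 1 else 0)) % 2 = 0 := by
  induction p with
  | nil => simp; split_ifs <;> rfl
  | @cons u y w h p ih =>
    have hmem : s(u, y) ∈ G.edgeFinset := by simpa using h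
    have h1 : ∀ e, (if x ∈ e then (SimpleGraph.Walk.cons h p).edges.count e else 0) =
        (if x ∈ e then p.edges.count e else 0) +
          if e = s(u, y) then (if x ∈ s(u, y) then 1 else 0) else 0 := by
      intro e
      rw [SimpleGraph.Walk.edges_cons, List.count_cons]
      by_cases he : e = s(u, y)
      · subst he
        by_cases hx : x ∈ s(u, y) <;> simp [hx]
      · simp [he, Ne.symm he]
    simp only [h1, Finset.sum_add_distrib, Finset.sum_ite_eq', hmem, if_true]
    have hne := h.ne
    simp only [Sym2.mem_iff]
    grind

/-- A solution of value at most `B` contains at least `|E(G)|` edges, and one more for every vertex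
of odd degree outside a vertex cover. -/
theorem card_edgeFinset_add_le {v : V} {k B : ℕ} {RC : Fin k → G.Walk v v} (hRC : IsSolution RC)
    (hB : value RC ≤ B) {S : Finset V} (hS : G.IsVertexCover (S : Set V)) :
    G.edgeFinset.card + (Finset.univ.filter fun x => x ∉ S ∧
      (∑ e ∈ G.edgeFinset, if x ∈ e then 1 else 0) % 2 = 1).card ≤ k * B := by
  -- `c e` is the total number of traversals of `e` by all robots.
  set c : Sym2 V → ℕ := fun e => ∑ i, (RC i).edges.count e with hc
  have hsum : ∑ e ∈ G.edgeFinset, c e ≤ k * B := by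
    rw [hc, Finset.sum_comm]
    have : ∀ i ∈ (Finset.univ : Finset (Fin k)),
        ∑ e ∈ G.edgeFinset, (RC i).edges.count e ≤ B := by
      intro i hi
      have h1 := Multiset.sum_count_eq_card (s := G.edgeFinset) (m := ((RC i).edges : Multiset _))
        fun e he => by
          simpa using (RC i).edges_subset_edgeSet (by simpa using he)
      simp only [Multiset.coe_count, Multiset.coe_card, SimpleGraph.Walk.length_edges] at h1
      rw [h1]
      exact (Finset.le_sup (f := fun i => (RC i).length) hi).trans hB
    simpa using Finset.sum_le_card_nsmul _ _ _ this
  have hpos : ∀ e ∈ G.edgeFinset, 1 ≤ c e := by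
    intro e he
    obtain ⟨i, hi⟩ := hRC e (by simpa using he)
    exact (List.one_le_count_iff.2 hi).trans
      (Finset.single_le_sum (f := fun i => (RC i).edges.count e) (fun _ _ => Nat.zero_le _)
        (Finset.mem_univ i))
  have heven : ∀ x, (∑ e ∈ G.edgeFinset, if x ∈ e then c e else 0) % 2 = 0 := by
    intro x
    have h1 : (∑ e ∈ G.edgeFinset, if x ∈ e then c e else 0) =
        ∑ i, ∑ e ∈ G.edgeFinset, if x ∈ e then (RC i).edges.count e else 0 := by
      rw [Finset.sum_comm]
      refine Finset.sum_congr rfl fun e _ => ?_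
      split_ifs <;> simp [hc]
    rw [h1]
    refine Nat.mod_eq_zero_of_dvd (Finset.dvd_sum fun i _ => ?_)
    have := even_sum_count_edges (RC i) x
    split_ifs at this <;> omega
  -- If every edge at `x` were traversed exactly once, the even total at `x` would equal its odd
  -- degree.
  have hex : ∀ x, x ∉ S ∧ (∑ e ∈ G.edgeFinset, if x ∈ e then 1 else 0) % 2 = 1 →
      ∃ e ∈ G.edgeFinset, x ∈ e ∧ 2 ≤ c e := by
    rintro x ⟨-, hodd⟩
    by_contra! hcon
    have : (∑ e ∈ G.edgeFinset, if x ∈ e then c e else 0) =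
        ∑ e ∈ G.edgeFinset, if x ∈ e then 1 else 0 := by
      refine Finset.sum_congr rfl fun e he => ?_
      split_ifs with hx
      · have := hcon e he hx
        have := hpos e he
        omega
      · rfl
    have := heven x
    omega
  have : Nonempty (Sym2 V) := ⟨s(v, v)⟩
  choose! g hg using hex
  have hcard : (Finset.univ.filter fun x => x ∉ S ∧
      (∑ e ∈ G.edgeFinset, if x ∈ e then 1 else 0) % 2 = 1).card ≤
      (G.edgeFinset.filter fun e => 2 ≤ c e).card := by
    refine Finset.card_le_card_of_injOn g ?_ ?_
    · intro x hx
      simp only [Finset.coe_filter, Finset.mem_univ, true_and, Set.mem_ofPred_eq] at hx ⊢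
      exact ⟨(hg x hx).1, (hg x hx).2.2⟩
    · intro x hx y hy hxy
      simp only [Finset.coe_filter, Finset.mem_univ, true_and, Set.mem_ofPred_eq] at hx hy
      by_contra hne
      have h1 := (hg x hx).2.1
      have h2 := (hg y hy).2.1
      rw [← hxy] at h2
      -- An edge chosen by two different vertices would join them, but both lie outside the vertex
      -- cover.
      have h3 := (Sym2.mem_and_mem_iff hne).1 ⟨h1, h2⟩
      have h4 := (hg x hx).1
      rw [h3, SimpleGraph.mem_edgeFinset, SimpleGraph.mem_edgeSet] at h4
      rcases hS h4 with h | h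
      · exact hx.1 (by simpa using h)
      · exact hy.1 (by simpa using h)
  have hle : ∑ e ∈ G.edgeFinset, (1 + if 2 ≤ c e then 1 else 0) ≤ ∑ e ∈ G.edgeFinset, c e := by
    refine Finset.sum_le_sum fun e he => ?_
    have := hpos e he
    split_ifs <;> omega
  rw [Finset.sum_add_distrib, Finset.sum_const, smul_eq_mul, mul_one, ← Finset.card_filter] at hle
  omega

end LowerBound

/-! ## Vertex covers and spanning trees -/

section Cover

variable {a b : ℕ → ℕ} {n m v : ℕ} {S : Finset ℕ}

theorem Joins.mem_or_mem (hS : ∀ e < m, a e ∈ S ∨ b e ∈ S) {e x y : ℕ} (he : e < m)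
    (h : Joins a b e x y) : x ∈ S ∨ y ∈ S := by
  have := hS e he
  unfold Joins at h
  grind

/-- The lower ends of the doubled edges are distinct, and each lies in `S`, is the parent of a
member of `S`, or has odd degree outside `S`. -/
theorem Augments.le_add {par dep ord : ℕ → ℕ} {cnt : ℕ} {a' b' : ℕ → ℕ} {M : ℕ}
    (h : Augments a b m par ord cnt a' b' M) (hT : IsTree a b n m v par dep ord cnt)
    (hS : ∀ e < m, a e ∈ S ∨ b e ∈ S) :
    M ≤ m + ((Finset.range n).filter fun x => x ∉ S ∧ edgeDegree a b m x % 2 = 1).card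
      + 2 * S.card := by
  have hle := h.le
  have hcard : (Finset.Ico m M).card ≤ (S ∪ S.image (fun x => par x - 1) ∪
      (Finset.range n).filter fun x => x ∉ S ∧ edgeDegree a b m x % 2 = 1).card := by
    refine Finset.card_le_card_of_injOn a' ?_ ?_
    · intro e he
      simp only [Finset.coe_Ico, Set.mem_Ico] at he
      obtain ⟨i, hi, hi', h1, -, hor⟩ := h.new e he.1 he.2
      simp only [Finset.coe_union, Finset.coe_image, Finset.coe_filter, Finset.mem_range,
        Set.mem_union, Set.mem_image, SetLike.mem_coe, Set.mem_ofPred_eq, h1]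
      by_cases hxS : ord i ∈ S
      · exact .inl (.inl hxS)
      rcases hor with hodd | ⟨j, hj, hj0, hp⟩
      · exact .inr ⟨(hT.ord_lt i hi').1, hxS, hodd⟩
      -- The tree edge to the child must be covered, so if `ord i` is not in `S`, then the child is.
      · obtain ⟨r, -, h2, -, f, hf, hjo⟩ := hT.parent j hj hj0
        have h3 : ord r = ord i := by omega
        rw [h3] at hjo
        exact .inl (.inr ⟨ord j, (hjo.mem_or_mem hS hf).resolve_right hxS, by omega⟩)
    · intro e he f hf hef
      simp only [Finset.coe_Ico, Set.mem_Ico] at he hf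
      exact h.inj e f he.1 he.2 hf.1 hf.2 hef
  have h1 := Finset.card_union_le (S ∪ S.image (fun x => par x - 1))
    ((Finset.range n).filter fun x => x ∉ S ∧ edgeDegree a b m x % 2 = 1)
  have h2 := Finset.card_union_le S (S.image (fun x => par x - 1))
  have h3 := Finset.card_image_le (s := S) (f := fun x => par x - 1)
  rw [Nat.card_Ico] at hcard
  omega

/-- On the path to the root the vertices of depths `2 * i` and `2 * i + 1` are adjacent, so one of
them is in `S`. Halving the depth separates these pairs, which gives `(dep x + 1) / 2` distinct
members of `S`. -/
theorem IsRooted.dep_le {par dep : ℕ → ℕ} (h : IsRooted a b n m v par dep)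
    (hS : ∀ e < m, a e ∈ S ∨ b e ∈ S) {x : ℕ} (hx : x < n) : dep x ≤ 2 * S.card := by
  have key : ∀ d x, x < n → dep x = d → ∀ i, 2 * i + 1 ≤ d → ∃ y ∈ S, dep y / 2 = i := by
    intro d
    induction d with
    | zero => intro x _ _ i hi; omega
    | succ d ih =>
      intro x hx hd i hi
      obtain ⟨h1, h2, e, he, hj⟩ := h.parent x hx (by omega)
      by_cases hid : 2 * i + 1 ≤ d
      · exact ih _ h1 (by omega) i hid
      · rcases hj.mem_or_mem hS he with hm | hm
        · exact ⟨_, hm, by omega⟩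
        · exact ⟨_, hm, by omega⟩
  have hsub : Finset.range ((dep x + 1) / 2) ⊆ S.image fun y => dep y / 2 := by
    intro i hi
    have := Finset.mem_range.1 hi
    obtain ⟨y, hy, hyi⟩ := key _ x hx rfl i (by omega)
    exact Finset.mem_image.2 ⟨y, hy, hyi⟩
  have h1 := Finset.card_le_card hsub
  have h2 := Finset.card_image_le (s := S) (f := fun y => dep y / 2)
  rw [Finset.card_range] at h1
  omega

end Cover

/-! ## Edge lists -/

section EdgeList

variable {n : ℕ} {G : SimpleGraph (Fin n)} {L : List (Fin n × Fin n)} {v : Fin n} {k : ℕ}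

theorem input_arr_zero {e : ℕ} (he : e < L.length) : (input L v k).arr 0 e = (L[e].1 : ℕ) := by
  simp [input, he]

theorem input_arr_one {e : ℕ} (he : e < L.length) : (input L v k).arr 1 e = (L[e].2 : ℕ) := by
  simp [input, he]

theorem ListsEdges.adj (hL : ListsEdges G L) {e : ℕ} (he : e < L.length) :
    G.Adj L[e].1 L[e].2 := by
  rw [← SimpleGraph.mem_edgeSet, ← hL.2]
  exact List.mem_map.2 ⟨L[e], List.getElem_mem he, rfl⟩

theorem ListsEdges.exists_index (hL : ListsEdges G L) {x y : Fin n} (h : G.Adj x y) :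
    ∃ e, ∃ he : e < L.length, s(L[e].1, L[e].2) = s(x, y) := by
  rw [← SimpleGraph.mem_edgeSet, ← hL.2, List.mem_map] at h
  obtain ⟨p, hp, hxy⟩ := h
  obtain ⟨e, he, rfl⟩ := List.mem_iff_getElem.1 hp
  exact ⟨e, he, hxy⟩

theorem ListsEdges.toFinset [DecidableRel G.Adj] (hL : ListsEdges G L) :
    (L.map fun p => s(p.1, p.2)).toFinset = G.edgeFinset := by
  ext e
  rw [List.mem_toFinset, hL.2, SimpleGraph.mem_edgeFinset]

theorem ListsEdges.card [DecidableRel G.Adj] (hL : ListsEdges G L) :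
    G.edgeFinset.card = L.length := by
  rw [← hL.toFinset, List.toFinset_card_of_nodup hL.1, List.length_map]

/-- As `G` has no loops, the two endpoint indicators of an edge never both hit `x`. -/
theorem ListsEdges.edgeDegree_eq [DecidableRel G.Adj] (hL : ListsEdges G L) (x : Fin n) :
    edgeDegree ((input L v k).arr 0) ((input L v k).arr 1) L.length x =
      ∑ e ∈ G.edgeFinset, if x ∈ e then 1 else 0 := by
  rw [← hL.toFinset, List.sum_toFinset _ hL.1, List.map_map, ← Fin.sum_univ_fun_getElem,
    edgeDegree, unusedDegree, ← Fin.sum_univ_eq_sum_range]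
  refine Finset.sum_congr rfl fun e _ => ?_
  rw [input_arr_zero e.2, input_arr_one e.2]
  have hne := (hL.adj e.2).ne
  simp only [Function.comp, Sym2.mem_iff, Fin.val_inj]
  grind

theorem ListsEdges.isConn (hL : ListsEdges G L) (hG : G.Connected) :
    IsConn ((input L v k).arr 0) ((input L v k).arr 1) n L.length v := by
  intro P hv hP x hx
  obtain ⟨p⟩ := hG.preconnected v ⟨x, hx⟩
  have key : ∀ (u w : Fin n) (p : G.Walk u w), P u → P w := by
    intro u w p
    induction p with
    | nil => exact id
    | @cons u y w h p ih =>
      intro hu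
      refine ih ?_
      obtain ⟨e, he, hxy⟩ := hL.exists_index h
      have := hP e he
      rw [input_arr_zero he, input_arr_one he] at this
      rcases Sym2.eq_iff.1 hxy with ⟨h1, h2⟩ | ⟨h1, h2⟩
      · rw [h1, h2] at this; exact this.1 hu
      · rw [h1, h2] at this; exact this.2 hu
  exact key _ _ p hv

end EdgeList

/-! ### From vertex sequences to walks, and the value of the solution -/

theorem exists_walk_of_adj {V : Type*} {G : SimpleGraph V} (f : ℕ → V) (len : ℕ)
    (h : ∀ t < len, G.Adj (f t) (f (t + 1))) :
    ∃ p : G.Walk (f 0) (f len), p.length = len ∧ (∀ t ≤ len, p.getVert t = f t) ∧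
      ∀ t < len, s(f t, f (t + 1)) ∈ p.edges := by
  induction len generalizing f with
  | zero => exact ⟨.nil, rfl, fun t ht => by simp [Nat.le_zero.1 ht], fun t ht => by omega⟩
  | succ len ih =>
    obtain ⟨p, hl, hv, he⟩ := ih (fun t => f (t + 1)) fun t ht => h (t + 1) (by omega)
    refine ⟨.cons (h 0 (by omega)) p, by simp [hl], fun t ht => ?_, fun t ht => ?_⟩
    · cases t with
      | zero => rfl
      | succ t => exact hv t (by omega)
    · cases t with
      | zero => simp
      | succ t => simpa using .inr (he t (by omega))

theorem exists_walk_of_isRoute {n : ℕ} {G : SimpleGraph (Fin n)} {a b : ℕ → ℕ} {M : ℕ} {v : Fin n}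
    {dep out f : ℕ → ℕ} {i j len : ℕ}
    (hadj : ∀ e < M, ∀ x y, Joins a b e x y → ∃ (hx : x < n) (hy : y < n), G.Adj ⟨x, hx⟩ ⟨y, hy⟩)
    (h : IsRoute a b M v dep out i j f len) :
    ∃ p : G.Walk v v, p.length = len ∧ (∀ t ≤ len, f t = (p.getVert t : ℕ)) ∧
      ∀ t, i ≤ t → t < j → ∀ (hx : out t < n) (hy : out (t + 1) < n),
        s(⟨out t, hx⟩, ⟨out (t + 1), hy⟩) ∈ p.edges := by
  have hlt : ∀ t ≤ len, f t < n := by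
    intro t ht
    rcases Nat.lt_or_ge t len with hl | hl
    · obtain ⟨e, he, hj⟩ := h.adj t hl
      exact (hadj e he _ _ hj).1
    · rw [show t = len by omega, h.last]; exact v.2
  -- The default `v` is never met at the indices `t ≤ len` that matter.
  set F : ℕ → Fin n := fun t => if ht : f t < n then ⟨f t, ht⟩ else v with hF
  have hFt : ∀ t ≤ len, ∀ ht : f t < n, F t = ⟨f t, ht⟩ := fun t _ ht => by simp [hF, ht]
  have h0 : F 0 = v := by
    rw [hFt 0 (by omega) (hlt 0 (by omega))]; exact Fin.ext h.first
  have h1 : F len = v := by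
    rw [hFt len le_rfl (hlt len le_rfl)]; exact Fin.ext h.last
  obtain ⟨p, hl, hv, he⟩ := exists_walk_of_adj (G := G) F len fun t ht => by
    obtain ⟨e, he, hj⟩ := h.adj t ht
    obtain ⟨hx, hy, hxy⟩ := hadj e he _ _ hj
    rwa [hFt t ht.le hx, hFt (t + 1) ht hy]
  refine ⟨p.copy h0 h1, by simpa using hl, fun t ht => ?_, fun t ht ht' hx hy => ?_⟩
  · rw [SimpleGraph.Walk.getVert_copy, hv t ht, hFt t ht (hlt t ht)]
  · obtain ⟨r, hr, h2, h3⟩ := h.cover t ht ht'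
    have := he r hr
    rw [hFt r hr.le (hlt r hr.le), hFt (r + 1) hr (hlt _ hr)] at this
    simpa [h2, h3] using this

theorem sum_filter_lt_eq_offset {k : ℕ} (len : ℕ → ℕ) (i : Fin k) :
    ∑ j ∈ Finset.univ.filter (· < i), (len j + 1) = offset len i := by
  refine Finset.sum_nbij (fun j => (j : ℕ)) ?_ ?_ ?_ fun _ _ => rfl
  · intro j hj
    simpa using hj
  · intro j _ j' _ h
    exact Fin.ext h
  · intro j hj
    have hj : j < (i : ℕ) := by simpa using hj
    exact ⟨⟨j, hj.trans i.2⟩, Finset.mem_coe.2 (Finset.mem_filter.2 ⟨Finset.mem_univ _, hj⟩), rfl⟩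

/-- The output of the algorithm is a solution of small value. -/
theorem IsResult.exists_solution {n : ℕ} {G : SimpleGraph (Fin n)} {L : List (Fin n × Fin n)}
    {v : Fin n} {k : ℕ} (hL : ListsEdges G L) {s : State}
    (h : IsResult ((input L v k).arr 0) ((input L v k).arr 1) n L.length v k s)
    {S : Finset (Fin n)} (hS : G.IsVertexCover (S : Set (Fin n))) :
    ∃ RC : Fin k → G.Walk v v, Outputs s RC ∧ IsSolution RC ∧
      value RC ≤ opt G v k + 8 * S.card := by
  classical
  obtain ⟨par₁, dep₁, ord₁, cnt₁, a', b', M, par, dep, out, B, hT, haug, hR, htour, hB, hB', hdone⟩ :=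
    h
  have hab : ∀ e < L.length, (input L v k).arr 0 e < n ∧ (input L v k).arr 1 e < n ∧
      (input L v k).arr 0 e ≠ (input L v k).arr 1 e := by
    intro e he
    rw [input_arr_zero he, input_arr_one he]
    exact ⟨L[e].1.2, L[e].2.2, fun h => (hL.adj he).ne (Fin.ext h)⟩
  have hadj₀ : ∀ e < L.length, ∀ x y, Joins ((input L v k).arr 0) ((input L v k).arr 1) e x y →
      ∃ (hx : x < n) (hy : y < n), G.Adj ⟨x, hx⟩ ⟨y, hy⟩ := by
    intro e he x y hj
    unfold Joins at hj
    rw [input_arr_zero he, input_arr_one he] at hj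
    have := hL.adj he
    rcases hj with ⟨rfl, rfl⟩ | ⟨rfl, rfl⟩
    · exact ⟨_, _, this⟩
    · exact ⟨_, _, this.symm⟩
  have hadj : ∀ e < M, ∀ x y, Joins a' b' e x y →
      ∃ (hx : x < n) (hy : y < n), G.Adj ⟨x, hx⟩ ⟨y, hy⟩ := by
    intro e he x y hj
    obtain ⟨-, f, hf, hjo⟩ := haug.lt hT hab he
    rcases hj with ⟨rfl, rfl⟩ | ⟨rfl, rfl⟩
    · exact hadj₀ f hf _ _ hjo
    · exact hadj₀ f hf _ _ hjo.symm
  have hout : ∀ t ≤ M, out t < n := by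
    intro t ht
    rcases Nat.lt_or_ge t M with hl | hl
    · obtain ⟨e, he, hj⟩ := htour.adj t hl
      exact (hadj e he _ _ hj).1
    · rw [show t = M by omega, htour.last]; exact v.2
  choose RC hlen hvert hedge using fun i : Fin k => exists_walk_of_isRoute hadj (hdone i i.2)
  have hsol : IsSolution RC := by
    intro e he
    induction e with
    | _ x y =>
    obtain ⟨j, hj, hxy⟩ := hL.exists_index he
    have hjM : j < M := hj.trans_le haug.le
    obtain ⟨t, ht, hjo⟩ := htour.cover j hjM
    have hBpos : 0 < B := by
      rcases Nat.eq_zero_or_pos B with rfl | h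
      · omega
      · exact h
    -- The tour edge with index `t` belongs to block `t / B`, and `t < M ≤ k * B`.
    have hik : t / B < k := by
      rw [Nat.div_lt_iff_lt_mul hBpos]; omega
    refine ⟨⟨t / B, hik⟩, ?_⟩
    have h1 : t / B * B ≤ t := Nat.div_mul_le_self t B
    have h2 : t < (t / B + 1) * B := Nat.lt_mul_of_div_lt (Nat.lt_succ_self _) hBpos
    have := hedge ⟨t / B, hik⟩ t (le_trans (min_le_left _ _) h1) (lt_min h2 ht)
      (hout t ht.le) (hout (t + 1) ht)
    have heq : s(x, y) = s((⟨out t, hout t ht.le⟩ : Fin n), ⟨out (t + 1), hout (t + 1) ht⟩) := by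
      rw [← hxy]
      unfold Joins at hjo
      rw [(haug.old j hj).1, (haug.old j hj).2, input_arr_zero hj, input_arr_one hj] at hjo
      rcases hjo with ⟨h3, h4⟩ | ⟨h3, h4⟩
      · exact Sym2.eq_iff.2 (.inl ⟨Fin.ext h3, Fin.ext h4⟩)
      · exact Sym2.eq_iff.2 (.inr ⟨Fin.ext h3, Fin.ext h4⟩)
    rwa [heq]
  refine ⟨RC, fun i => ⟨(hlen i).symm, fun j hj => ?_⟩, hsol, ?_⟩
  · rw [← hvert i j (by rw [← hlen i]; exact hj), ← sum_filter_lt_eq_offset]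
    simp only [hlen]
  have hS' : ∀ e < L.length, (input L v k).arr 0 e ∈ S.map Fin.valEmbedding ∨
      (input L v k).arr 1 e ∈ S.map Fin.valEmbedding := by
    intro e he
    rw [input_arr_zero he, input_arr_one he]
    exact (hS (hL.adj he)).imp (fun h => Finset.mem_map_of_mem _ (by simpa using h))
      fun h => Finset.mem_map_of_mem _ (by simpa using h)
  have hS'' : ∀ e < M, a' e ∈ S.map Fin.valEmbedding ∨ b' e ∈ S.map Fin.valEmbedding := by
    intro e he
    obtain ⟨-, f, hf, hjo⟩ := haug.lt hT hab he
    exact hjo.mem_or_mem hS' hf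
  have hM := haug.le_add hT hS'
  have hodd : ((Finset.range n).filter fun x => x ∉ S.map Fin.valEmbedding ∧
      edgeDegree ((input L v k).arr 0) ((input L v k).arr 1) L.length x % 2 = 1).card =
      (Finset.univ.filter fun x => x ∉ S ∧
      (∑ e ∈ G.edgeFinset, if x ∈ e then 1 else 0) % 2 = 1).card := by
    rw [← Finset.card_map Fin.valEmbedding]
    congr 1
    ext x
    simp only [Finset.mem_filter, Finset.mem_range, Finset.mem_map, Finset.mem_univ, true_and,
      Fin.valEmbedding_apply, ← hL.edgeDegree_eq (v := v) (k := k)]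
    constructor
    · rintro ⟨hx, h1, h2⟩
      exact ⟨⟨x, hx⟩, ⟨fun h => h1 ⟨_, h, rfl⟩, h2⟩, rfl⟩
    · rintro ⟨y, ⟨h1, h2⟩, rfl⟩
      refine ⟨y.2, ?_, h2⟩
      rintro ⟨z, hz, hzy⟩
      exact h1 (Fin.ext hzy ▸ hz)
  -- The infimum is attained because the solution just constructed shows that the set of values is
  -- nonempty.
  obtain ⟨RC', hRC', hval⟩ : opt G v k ∈ {B | ∃ RC : Fin k → G.Walk v v,
      IsSolution RC ∧ value RC = B} := Nat.sInf_mem ⟨_, RC, hsol, rfl⟩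
  have hlow := card_edgeFinset_add_le hRC' hval.le hS
  rw [hL.card] at hlow
  rw [hodd, Finset.card_map] at hM
  refine Finset.sup_le fun i _ => ?_
  have hk : 0 < k := i.pos
  -- Combining the bounds gives `k * B < k * opt + 2 * S.card + k`, and rounding costs nothing since
  -- `B` is an integer.
  have hBle : B ≤ opt G v k + 2 * S.card := by
    by_contra hcon
    have h1 := Nat.mul_le_mul_left k (show opt G v k + 2 * S.card + 1 ≤ B by omega)
    have h2 : 2 * S.card ≤ k * (2 * S.card) := Nat.le_mul_of_pos_left _ hk
    rw [Nat.mul_add, Nat.mul_add, mul_one] at h1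
    omega
  have hle := (hdone i i.2).len_eq
  have hsucc : ((i : ℕ) + 1) * B = i * B + B := Nat.succ_mul _ _
  have hd₁ := hR.dep_le hS'' (hout (min (i * B) M) (min_le_right _ _))
  have hd₂ := hR.dep_le hS'' (hout (min ((i + 1) * B) M) (min_le_right _ _))
  rw [Finset.card_map] at hd₁ hd₂
  rw [hlen i]
  -- The cycle consists of a block of at most `B` edges and two tree paths of at most `2 * S.card`
  -- edges each.
  omega

end CGE

theorem mainTheorem2 :
    ∃ (P : CGE.Prog) (C : ℕ),
      ∀ (n : ℕ) (G : SimpleGraph (Fin n)) (L : List (Fin n × Fin n)) (v : Fin n) (k : ℕ),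
        G.Connected → CGE.ListsEdges G L → 1 ≤ k →
          ∃ (t : ℕ) (s : CGE.State) (RC : Fin k → G.Walk v v),
            CGE.Run (C * ((n + G.edgeSet.ncard) * k)) P (CGE.input L v k) t s ∧
            t ≤ C * ((n + G.edgeSet.ncard) * k) ∧
            CGE.Outputs s RC ∧
            CGE.IsSolution RC ∧
            (CGE.value RC : ℕ∞) ≤ (CGE.opt G v k : ℕ∞) + 8 * G.vertexCoverNum := by
  refine ⟨CGE.exploration, 20000, fun n G L v k hG hL hk => ?_⟩
  classical
  have hm : G.edgeSet.ncard = L.length := by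
    rw [← hL.card, ← SimpleGraph.coe_edgeFinset, Set.ncard_coe_finset]
  -- The cover enters the analysis only, never the program, so a minimum one may be chosen here.
  obtain ⟨S, hS, hcover⟩ := SimpleGraph.vertexCoverNum_exists G
  obtain ⟨t, s, hrun, ht, hres⟩ := CGE.runs_exploration (W := 20000 * ((n + L.length) * k))
    (s := CGE.input L v k) (n := n) (m := L.length) (v := v) (k := k) rfl rfl rfl rfl
    (fun x => by simp [CGE.input]) v.2 hk (fun e he => by
      rw [CGE.input_arr_zero he, CGE.input_arr_one he]
      exact ⟨L[e].1.2, L[e].2.2, fun h => (hL.adj he).ne (Fin.ext h)⟩) (hL.isConn hG) le_rfl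
  obtain ⟨RC, hout, hsol, hval⟩ := hres.exists_solution hL (S := S.toFinset) (by simpa using hcover)
  refine ⟨t, s, RC, hm ▸ hrun, hm ▸ ht, hout, hsol, ?_⟩
  rw [← hS, Set.encard_eq_coe_toFinset_card]
  exact_mod_cast hval
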